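/- Conventions. Let $G$ be a simple graph (finite or infinite, not necessarily connected), with $d$ its shortest-path distance; $d=\infty$ between different components. A branch of $G$ is a path or cycle (a finite subgraph) in which every internal vertex has degree two in $G$ (for a cycle: every vertex except possibly one, taken as its start and end) and which is maximal, as a subgraph, among such paths and cycles. Each branch is traversed from one end to the other (a cycle from its start vertex, in one of the two directions, back to it). Write $X_0,X_1,\dots,X_{|X|}$ for the successive vertices of a branch $X$; for a cycle $X_0=X_{|X|}$. For branches $A,B$ (possibly equal) and a vertex $s$, the indistinct set of $s$ for $(A,B)$ consists of the pairs of a vertex of $A$ and a vertex of $B$ that are equally far from $s$; plotted by positions it is $$I_s=\{(i,j)\in\mathbb Z^2 : 0\le i\le |A|,\ 0\le j\le |B|,\ d(s,A_i)=d(s,B_j)\}.$$ The diagonals of $I_s$ are the inclusion-maximal sets of the form $\{(x+k,y+\sigma k):0\le k\le n\}\subseteq I_s$ with $\sigma\in\{1,-1\}$, $n\ge 0$; a diagonal is also viewed as the line segment in $\mathbb R^2$ spanned by its points (a one-point diagonal is a degenerate segment, regarded as having both slopes). Two indistinct sets are combinatorially equivalent if there is a bijection between their diagonals such that, in both directions,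 (i) slopes are preserved; (ii) two distinct diagonals intersect (as segments in $\mathbb R^2$) if and only if the corresponding diagonals do; (iii) if two diagonals both intersect a third one, then the west-to-east order of the two intersections along the third one is the same as for the corresponding diagonals. The combinatorial structure of an indistinct set is its class under this equivalence relation. Statement. There is an absolute constant $K$ such that for every simple graph $G$ and all branches $A,B,C$ of $G$ (not necessarily distinct), with any choice of traversals, there are at most $K$ positions $k\in\{0,\dots,|C|-1\}$ for which the indistinct sets of $C_k$ and of $C_{k+1}$ for $(A,B)$ have different combinatorial structures. -/

import Mathlib

namespace Branches

/-- A walk in `G` that traces a path or a cycle all of whose internal vertices have degree two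
in `G`.  For a cycle, written as a closed walk, the internal vertices are all of its vertices
except possibly the one at which the walk starts and ends. -/
structure IsThread {V : Type*} (G : SimpleGraph V) {u v : V} (p : G.Walk u v) : Prop where
  path_or_cycle : p.IsPath ∨ ∃ h : v = u, (p.copy rfl h).IsCycle
  internal : ∀ i : ℕ, 0 < i → i < p.length → (G.neighborSet (p.getVert i)).ncard = 2

/-- A branch of `G`: a maximal (as a subgraph) path or cycle in which every internal vertex
has degree two in `G`, given together with one of its traversals. -/
def IsBranch {V : Type*} (G : SimpleGraph V) {u v : V} (p : G.Walk u v) : Prop :=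
  IsThread G p ∧ ∀ (x y : V) (q : G.Walk x y), IsThread G q →
    p.toSubgraph ≤ q.toSubgraph → q.toSubgraph ≤ p.toSubgraph

/-- The indistinct set of the vertex `s` for the pair of branches `(A, B)`, plotted with the
position along `A` and the position along `B` as Cartesian coordinates: all `(i, j)` such that
the `i`-th vertex of `A` and the `j`-th vertex of `B` have the same distance from `s`.
Distances between different connected components are infinite. -/
def indistinctSet {V : Type*} (G : SimpleGraph V) {a a' b b' : V}
    (A : G.Walk a a') (B : G.Walk b b') (s : V) : Set (ℤ × ℤ) :=
  {z | ∃ i j : ℕ, i ≤ A.length ∧ j ≤ B.length ∧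
    G.edist s (A.getVert i) = G.edist s (B.getVert j) ∧ z = ((i : ℤ), (j : ℤ))}

/-- All points of `D` lie on a common line of slope `σ`. -/
def HasSlope (D : Set (ℤ × ℤ)) (σ : ℤ) : Prop :=
  ∀ p ∈ D, ∀ q ∈ D, q.2 - p.2 = σ * (q.1 - p.1)

/-- Finitely many (at least one) consecutive lattice points on a line of slope `1` or `-1`. -/
def IsRun (D : Set (ℤ × ℤ)) : Prop :=
  ∃ (x y σ : ℤ) (n : ℕ), (σ = 1 ∨ σ = -1) ∧
    D = {z | ∃ k : ℕ, k ≤ n ∧ z = (x + (k : ℤ), y + σ * (k : ℤ))}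

/-- The diagonals of a planar lattice set `I`: its inclusion-maximal runs of slope `±1`.
(A diagonal with a single point is a point of `I` that has no diagonal neighbour in `I`.) -/
def IsDiagonal (I D : Set (ℤ × ℤ)) : Prop :=
  Maximal (fun E => IsRun E ∧ E ⊆ I) D

/-- The line segment in the plane drawn through the lattice points of a diagonal. -/
def segmentOf (D : Set (ℤ × ℤ)) : Set (ℝ × ℝ) :=
  convexHull ℝ ((fun z : ℤ × ℤ => ((z.1 : ℝ), (z.2 : ℝ))) '' D)

/-- Two different diagonals intersect each other, as line segments in the plane. -/
def Cross (D E : Set (ℤ × ℤ)) : Prop :=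
  D ≠ E ∧ (segmentOf D ∩ segmentOf E).Nonempty

/-- `E` and `F` both intersect the diagonal `D`, and along `D` the intersection with `E` lies
strictly to the west of the intersection with `F`.  (On a segment of slope `-1` this is the
northwest-to-southeast order, on one of slope `1` the southwest-to-northeast order.) -/
def CrossBefore (D E F : Set (ℤ × ℤ)) : Prop :=
  Cross D E ∧ Cross D F ∧
    ∀ P ∈ segmentOf D ∩ segmentOf E, ∀ Q ∈ segmentOf D ∩ segmentOf F, P.1 < Q.1

/-- Combinatorial equivalence: a one-to-one correspondence between the diagonals that preserves
slopes, intersections, and the order of intersections along each diagonal. -/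
def CombEquiv (I J : Set (ℤ × ℤ)) : Prop :=
  ∃ e : {D : Set (ℤ × ℤ) // IsDiagonal I D} ≃ {D : Set (ℤ × ℤ) // IsDiagonal J D},
    (∀ D, ∀ σ : ℤ, σ = 1 ∨ σ = -1 → (HasSlope D.1 σ ↔ HasSlope (e D).1 σ)) ∧
    (∀ D E, Cross D.1 E.1 ↔ Cross (e D).1 (e E).1) ∧
    (∀ D E F, CrossBefore D.1 E.1 F.1 ↔ CrossBefore (e D).1 (e E).1 (e F).1)

theorem CombEquiv.equivalence : Equivalence CombEquiv where
  refl I := ⟨Equiv.refl _, by simp, by simp, by simp⟩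
  symm := by
    rintro I J ⟨e, h1, h2, h3⟩
    refine ⟨e.symm, fun D σ hσ => ?_, fun D E => ?_, fun D E F => ?_⟩
    · simpa using (h1 (e.symm D) σ hσ).symm
    · simpa using (h2 (e.symm D) (e.symm E)).symm
    · simpa using (h3 (e.symm D) (e.symm E) (e.symm F)).symm
  trans := by
    rintro I J K ⟨e, h1, h2, h3⟩ ⟨f, g1, g2, g3⟩
    refine ⟨e.trans f, fun D σ hσ => ?_, fun D E => ?_, fun D E F => ?_⟩
    · exact (h1 D σ hσ).trans (g1 _ σ hσ)
    · exact (h2 D E).trans (g2 _ _)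
    · exact (h3 D E F).trans (g3 _ _ _)

/-- The combinatorial structure of a planar lattice set is its class under combinatorial
equivalence. -/
def combSetoid : Setoid (Set (ℤ × ℤ)) := ⟨CombEquiv, CombEquiv.equivalence⟩

def combStructure (I : Set (ℤ × ℤ)) : Quotient combSetoid := Quotient.mk combSetoid I

/-- The positions `k` along `C` at which the combinatorial structure of the indistinct set for
`(A, B)` changes, that is, differs between the `k`-th vertex of `C` and the next one. -/
def changePositions {V : Type*} (G : SimpleGraph V) {a a' b b' c c' : V}
    (A : G.Walk a a') (B : G.Walk b b') (C : G.Walk c c') : Set ℕ :=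
  {k | k < C.length ∧ combStructure (indistinctSet G A B (C.getVert k)) ≠
    combStructure (indistinctSet G A B (C.getVert (k + 1)))}

end Branches

/-! Seen from a vertex `s`, the distance along a branch `A` has no local minimum at an internal
vertex other than `s`: the only neighbours of such a vertex are its two neighbours on `A`, and one
of them is nearer to `s`. A 1-Lipschitz function without interior valley is the minimum of a rising
and a falling line (`eq_min_of_no_valley`). After cutting `A` at `s`, if `s` is internal to it, four
runs of slope ±1, some possibly empty, describe all distances (`IsThread.profile_traces`). Pairing
each run for `A` with each run for `B` gives 16 runs that fill the indistinct set
(`Traces.fills_pairing`).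

The diagonals arise by merging runs that touch on a common line. Slopes being fixed, containment,
crossing and the order of crossings are all decided by comparing finitely many integers, the marks.
Hence two sets whose marks are in the same order have the same combinatorial structure
(`SamePattern.combEquiv`).

While `s` moves along `C`, every mark is a sequence whose increment changes boundedly often. Indeed
the distance to an end of `A` changes steadily by ±1 outside a few positions
(`IsThread.exists_steady_dist`), and so does the position of `s` on `A` while `C` runs inside `A`
(`IsThread.profile_tameFamily`). The difference of two such sequences changes sign boundedly often
(`Tame.card_signChanges_le`), and the number of pairs of marks is an absolute constant. If `A` or
`B` lies outside the component of `C`, the indistinct set is constant along `C`. -/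

namespace Branches

/-! ### Lattice runs of slope ±1 and their segments. -/

/-- The lattice points with abscissa between `a` and `b` on the line `y = c + σ x`. -/
def lineRun (σ c a b : ℤ) : Set (ℤ × ℤ) :=
  {z | a ≤ z.1 ∧ z.1 ≤ b ∧ z.2 = c + σ * z.1}

theorem isRun_lineRun {σ c a b : ℤ} (hσ : σ = 1 ∨ σ = -1) (hab : a ≤ b) :
    IsRun (lineRun σ c a b) := by
  refine ⟨a, c + σ * a, σ, (b - a).toNat, hσ, ?_⟩
  ext ⟨x, y⟩
  simp only [lineRun, Set.mem_ofPred_eq, Prod.mk.injEq]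
  constructor
  · rintro ⟨h1, h2, h3⟩
    refine ⟨(x - a).toNat, by omega, by omega, ?_⟩
    rw [Int.toNat_of_nonneg (by omega), h3]
    ring
  · rintro ⟨k, hk, rfl, rfl⟩
    refine ⟨by omega, by omega, by ring⟩

theorem IsRun.exists_lineRun {D : Set (ℤ × ℤ)} (h : IsRun D) :
    ∃ σ c a b : ℤ, (σ = 1 ∨ σ = -1) ∧ a ≤ b ∧ D = lineRun σ c a b := by
  obtain ⟨x, y, σ, n, hσ, rfl⟩ := h
  refine ⟨σ, y - σ * x, x, x + n, hσ, by omega, ?_⟩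
  ext ⟨z, w⟩
  simp only [lineRun, Set.mem_ofPred_eq, Prod.mk.injEq]
  constructor
  · rintro ⟨k, hk, rfl, rfl⟩
    refine ⟨by omega, by omega, by ring⟩
  · rintro ⟨h1, h2, h3⟩
    refine ⟨(z - x).toNat, by omega, by omega, ?_⟩
    rw [Int.toNat_of_nonneg (by omega), h3]
    ring

theorem lineRun_subset_lineRun {σ c a b σ' c' a' b' : ℤ} (hσ : σ = 1 ∨ σ = -1)
    (hσ' : σ' = 1 ∨ σ' = -1) (hab : a ≤ b) :
    lineRun σ c a b ⊆ lineRun σ' c' a' b' ↔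
      a' ≤ a ∧ b ≤ b' ∧ c + σ * a = c' + σ' * a ∧ (σ = σ' ∨ a = b) := by
  constructor
  · intro h
    have h1 := @h (a, c + σ * a) ⟨le_rfl, hab, rfl⟩
    have h2 := @h (b, c + σ * b) ⟨hab, le_rfl, rfl⟩
    simp only [lineRun, Set.mem_ofPred_eq] at h1 h2
    refine ⟨h1.1, h2.2.1, h1.2.2, ?_⟩
    rcases hσ with rfl | rfl <;> rcases hσ' with rfl | rfl <;> omega
  · rintro ⟨h1, h2, h3, h4⟩ ⟨x, y⟩ ⟨g1, g2, g3⟩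
    simp only at g1 g2 g3
    refine ⟨by simp only; omega, by simp only; omega, ?_⟩
    simp only
    rcases h4 with rfl | rfl
    · omega
    · obtain rfl : x = a := by omega
      omega

theorem hasSlope_lineRun {σ c a b τ : ℤ} (hab : a ≤ b) :
    HasSlope (lineRun σ c a b) τ ↔ σ = τ ∨ a = b := by
  constructor
  · intro h
    have h1 := h (a, c + σ * a) ⟨le_rfl, hab, rfl⟩ (b, c + σ * b) ⟨hab, le_rfl, rfl⟩
    simp only at h1
    have h2 : (σ - τ) * (b - a) = 0 := by linarith
    rcases mul_eq_zero.1 h2 with h | h <;> omega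
  · rintro h ⟨x, y⟩ ⟨h1, h2, h3⟩ ⟨z, w⟩ ⟨g1, g2, g3⟩
    simp only at *
    rcases h with rfl | rfl
    · rw [h3, g3]; ring
    · obtain rfl : x = a := by omega
      obtain rfl : z = x := by omega
      rw [h3, g3]; ring

theorem segmentOf_lineRun {σ c a b : ℤ} (hab : a ≤ b) :
    segmentOf (lineRun σ c a b) =
      {P : ℝ × ℝ | (a : ℝ) ≤ P.1 ∧ P.1 ≤ b ∧ P.2 = c + σ * P.1} := by
  apply Set.Subset.antisymm
  · apply convexHull_min
    · rintro _ ⟨⟨x, y⟩, ⟨h1, h2, h3⟩, rfl⟩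
      simp only at h1 h2 h3
      refine ⟨Int.cast_le.2 h1, Int.cast_le.2 h2, ?_⟩
      simp only [h3]
      push_cast
      ring
    · rintro ⟨x, y⟩ ⟨h1, h2, h3⟩ ⟨z, w⟩ ⟨g1, g2, g3⟩ s t hs ht hst
      simp only at h1 h2 h3 g1 g2 g3
      simp only [Prod.smul_mk, smul_eq_mul, Prod.mk_add_mk, Set.mem_ofPred_eq]
      refine ⟨?_, ?_, ?_⟩
      · have e : (a : ℝ) = s * a + t * a := by rw [← add_mul, hst, one_mul]
        rw [e]
        gcongr
      · have e : (b : ℝ) = s * b + t * b := by rw [← add_mul, hst, one_mul]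
        rw [e]
        gcongr
      · rw [h3, g3]
        linear_combination (c : ℝ) * hst
  · rintro ⟨x, y⟩ ⟨h1, h2, h3⟩
    simp only at h1 h2 h3
    have ha : ((a : ℝ), (c + σ * a : ℝ)) ∈ (fun z : ℤ × ℤ => ((z.1 : ℝ), (z.2 : ℝ))) ''
        lineRun σ c a b := ⟨(a, c + σ * a), ⟨le_rfl, hab, rfl⟩, by simp⟩
    have hb : ((b : ℝ), (c + σ * b : ℝ)) ∈ (fun z : ℤ × ℤ => ((z.1 : ℝ), (z.2 : ℝ))) ''
        lineRun σ c a b := ⟨(b, c + σ * b), ⟨hab, le_rfl, rfl⟩, by simp⟩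
    refine segment_subset_convexHull ha hb ?_
    rcases hab.eq_or_lt with rfl | hlt
    · obtain rfl : x = a := le_antisymm h2 h1
      rw [h3]
      exact left_mem_segment ℝ _ _
    · have hlt' : (0 : ℝ) < b - a := by
        have : (a : ℝ) < b := Int.cast_lt.2 hlt
        linarith
      refine ⟨(b - x) / (b - a), (x - a) / (b - a), by apply div_nonneg <;> linarith,
        by apply div_nonneg <;> linarith, by field_simp; ring, ?_⟩
      simp only [Prod.smul_mk, smul_eq_mul, Prod.mk_add_mk, Prod.mk.injEq, h3]
      constructor <;> field_simp <;> ring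

/-! ### Families of runs and the order of their marks. -/

/-- A family of runs, each given by slope, intercept, and first and last abscissa. -/
structure RunFamily (Λ : Type*) where
  slope : Λ → ℤ
  icpt : Λ → ℤ
  left : Λ → ℤ
  right : Λ → ℤ

/-- Names for the abscissae attached to a family of runs: left ends, right ends, the positions
next to the right ends, and the abscissae at which the lines of two runs meet. -/
abbrev Mark (Λ : Type*) := Λ ⊕ Λ ⊕ Λ ⊕ Λ × Λ

namespace Mark
variable {Λ : Type*}

abbrev left (i : Λ) : Mark Λ := Sum.inl i
abbrev right (i : Λ) : Mark Λ := Sum.inr (Sum.inl i)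
abbrev next (i : Λ) : Mark Λ := Sum.inr (Sum.inr (Sum.inl i))
abbrev meet (i j : Λ) : Mark Λ := Sum.inr (Sum.inr (Sum.inr (i, j)))

end Mark

namespace RunFamily
variable {Λ : Type*}

/-- The points of a member of the family. -/
def run (M : RunFamily Λ) (i : Λ) : Set (ℤ × ℤ) :=
  lineRun (M.slope i) (M.icpt i) (M.left i) (M.right i)

/-- Twice the abscissa named by a mark. -/
def val (M : RunFamily Λ) : Mark Λ → ℤ
  | Sum.inl i => 2 * M.left i
  | Sum.inr (Sum.inl i) => 2 * M.right i
  | Sum.inr (Sum.inr (Sum.inl i)) => 2 * M.right i + 2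
  | Sum.inr (Sum.inr (Sum.inr (i, j))) => M.slope i * (M.icpt j - M.icpt i)

@[simp] theorem val_left (M : RunFamily Λ) (i : Λ) : M.val (Mark.left i) = 2 * M.left i := rfl
@[simp] theorem val_right (M : RunFamily Λ) (i : Λ) : M.val (Mark.right i) = 2 * M.right i := rfl
@[simp] theorem val_next (M : RunFamily Λ) (i : Λ) :
    M.val (Mark.next i) = 2 * M.right i + 2 := rfl
@[simp] theorem val_meet (M : RunFamily Λ) (i j : Λ) :
    M.val (Mark.meet i j) = M.slope i * (M.icpt j - M.icpt i) := rfl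

/-- Two families with equal slopes whose marks are in the same order. -/
structure SamePattern (M N : RunFamily Λ) : Prop where
  slope : ∀ i, M.slope i = N.slope i
  val : ∀ s t, M.val s ≤ M.val t ↔ N.val s ≤ N.val t

/-- All slopes are `1` or `-1`. -/
def Diagonal (M : RunFamily Λ) : Prop := ∀ i, M.slope i = 1 ∨ M.slope i = -1

/-- All runs are nonempty. -/
def Inhab (M : RunFamily Λ) : Prop := ∀ i, M.left i ≤ M.right i

/-- Since `meet i i` has value 0, comparing `meet i j` with it tests, for equal slopes, whether the
two lines coincide. For opposite slopes, containment forces a single point, namely the one where the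
lines meet. Every condition on the right is about slopes and the order of marks, so it transfers
between families of the same pattern. -/
theorem run_subset_run_iff {M : RunFamily Λ} (hd : M.Diagonal) (hn : M.Inhab) (i j : Λ) :
    M.run i ⊆ M.run j ↔
      (M.slope i = M.slope j ∧ M.val (.meet i j) ≤ M.val (.meet i i) ∧
        M.val (.meet i i) ≤ M.val (.meet i j) ∧ M.val (.left j) ≤ M.val (.left i) ∧
        M.val (.right i) ≤ M.val (.right j)) ∨
      (M.slope i ≠ M.slope j ∧ M.val (.right i) ≤ M.val (.left i) ∧
        M.val (.left i) ≤ M.val (.meet i j) ∧ M.val (.meet i j) ≤ M.val (.left i) ∧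
        M.val (.left j) ≤ M.val (.left i) ∧ M.val (.right i) ≤ M.val (.right j)) := by
  have hi := hn i
  rw [run, run, lineRun_subset_lineRun (hd i) (hd j) hi]
  simp only [val_left, val_right, val_meet]
  rcases hd i with h | h <;> rcases hd j with h' | h' <;> rw [h, h'] <;> omega

theorem hasSlope_run_iff {M : RunFamily Λ} (hn : M.Inhab) (i : Λ) (τ : ℤ) :
    HasSlope (M.run i) τ ↔ M.slope i = τ ∨ M.val (.right i) ≤ M.val (.left i) := by
  have hi := hn i
  rw [run, hasSlope_lineRun hi]
  simp only [val_left, val_right]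
  omega

theorem mem_segmentOf_run {M : RunFamily Λ} (hn : M.Inhab) {i : Λ} {P : ℝ × ℝ} :
    P ∈ segmentOf (M.run i) ↔
      (M.left i : ℝ) ≤ P.1 ∧ P.1 ≤ M.right i ∧ P.2 = M.icpt i + M.slope i * P.1 := by
  rw [run, segmentOf_lineRun (hn i)]
  rfl

open Classical in
/-- The marks bounding the intersection of two runs on the left. -/
noncomputable def lowMarks (M : RunFamily Λ) (i j : Λ) : Set (Mark Λ) :=
  if M.slope i = M.slope j then {.left i, .left j} else {.meet i j}

open Classical in
/-- The marks bounding the intersection of two runs on the right. -/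
noncomputable def highMarks (M : RunFamily Λ) (i j : Λ) : Set (Mark Λ) :=
  if M.slope i = M.slope j then {.right i, .right j} else {.meet i j}

theorem two_mul_eq_meet {M : RunFamily Λ} (hd : M.Diagonal) {i j : Λ}
    (h : M.slope i ≠ M.slope j) (x : ℝ) :
    (M.icpt i + M.slope i * x = M.icpt j + M.slope j * x) ↔ 2 * x = M.val (.meet i j) := by
  rw [val_meet]
  rcases hd i with h1 | h1 <;> rcases hd j with h2 | h2
  · exact absurd (h1.trans h2.symm) h
  · rw [h1, h2]; push_cast; constructor <;> intro h <;> linarith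
  · rw [h1, h2]; push_cast; constructor <;> intro h <;> linarith
  · exact absurd (h1.trans h2.symm) h

theorem inter_nonempty_iff {M : RunFamily Λ} (hd : M.Diagonal) (hn : M.Inhab) (i j : Λ) :
    (segmentOf (M.run i) ∩ segmentOf (M.run j)).Nonempty ↔
      (M.slope i = M.slope j ∧ M.val (.meet i j) ≤ M.val (.meet i i) ∧
        M.val (.meet i i) ≤ M.val (.meet i j) ∧ M.val (.left j) ≤ M.val (.right i) ∧
        M.val (.left i) ≤ M.val (.right j)) ∨
      (M.slope i ≠ M.slope j ∧ M.val (.left i) ≤ M.val (.meet i j) ∧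
        M.val (.meet i j) ≤ M.val (.right i) ∧ M.val (.left j) ≤ M.val (.meet i j) ∧
        M.val (.meet i j) ≤ M.val (.right j)) := by
  have hi := hn i
  have hj := hn j
  by_cases hs : M.slope i = M.slope j
  · have hc : (M.val (.meet i j) ≤ M.val (.meet i i) ∧ M.val (.meet i i) ≤ M.val (.meet i j)) ↔
        M.icpt i = M.icpt j := by
      simp only [val_meet]
      rcases hd i with h | h <;> rw [h] <;> omega
    simp only [hs, ne_eq, not_true_eq_false, false_and, or_false, true_and]
    rw [← and_assoc, hc]
    simp only [val_left, val_right]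
    constructor
    · rintro ⟨P, hP, hQ⟩
      rw [mem_segmentOf_run hn] at hP hQ
      refine ⟨?_, ?_, ?_⟩
      · have := hP.2.2.symm.trans hQ.2.2
        rw [hs] at this
        exact_mod_cast add_right_cancel this
      · have := hQ.1.trans hP.2.1
        have : M.left j ≤ M.right i := by exact_mod_cast this
        omega
      · have := hP.1.trans hQ.2.1
        have : M.left i ≤ M.right j := by exact_mod_cast this
        omega
    · rintro ⟨h1, h2, h3⟩
      refine ⟨(((max (M.left i) (M.left j) : ℤ) : ℝ),
        M.icpt i + M.slope i * ((max (M.left i) (M.left j) : ℤ) : ℝ)), ?_, ?_⟩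
      · rw [mem_segmentOf_run hn]
        refine ⟨?_, ?_, rfl⟩
        · exact Int.cast_le.2 (le_max_left _ _)
        · have : max (M.left i) (M.left j) ≤ M.right i := by omega
          exact Int.cast_le.2 this
      · rw [mem_segmentOf_run hn]
        refine ⟨?_, ?_, by rw [h1, hs]⟩
        · exact Int.cast_le.2 (le_max_right _ _)
        · have : max (M.left i) (M.left j) ≤ M.right j := by omega
          exact Int.cast_le.2 this
  · simp only [hs, ne_eq, not_false_eq_true, false_and, false_or, true_and]
    simp only [val_left, val_right]
    constructor
    · rintro ⟨P, hP, hQ⟩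
      rw [mem_segmentOf_run hn] at hP hQ
      have h := (two_mul_eq_meet hd hs P.1).1 (hP.2.2.symm.trans hQ.2.2)
      obtain ⟨a1, a2, -⟩ := hP
      obtain ⟨b1, b2, -⟩ := hQ
      refine ⟨?_, ?_, ?_, ?_⟩ <;>
      · rw [← Int.cast_le (R := ℝ), ← h]
        push_cast
        linarith
    · rintro ⟨h1, h2, h3, h4⟩
      rw [← Int.cast_le (R := ℝ)] at h1 h2 h3 h4
      push_cast [Int.cast_mul] at h1 h2 h3 h4
      have h := (two_mul_eq_meet hd hs ((M.val (.meet i j) : ℝ) / 2)).2 (by ring)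
      refine ⟨((M.val (.meet i j) : ℝ) / 2,
        M.icpt i + M.slope i * ((M.val (.meet i j) : ℝ) / 2)), ?_, ?_⟩
      · rw [mem_segmentOf_run hn]
        exact ⟨by simp only; linarith, by simp only; linarith, rfl⟩
      · rw [mem_segmentOf_run hn]
        exact ⟨by simp only; linarith, by simp only; linarith, h⟩

theorem le_of_mem_inter {M : RunFamily Λ} (hd : M.Diagonal) (hn : M.Inhab) {i j : Λ}
    {P : ℝ × ℝ} (hP : P ∈ segmentOf (M.run i) ∩ segmentOf (M.run j)) :
    (∀ t ∈ M.lowMarks i j, (M.val t : ℝ) ≤ 2 * P.1) ∧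
      ∀ t ∈ M.highMarks i j, 2 * P.1 ≤ (M.val t : ℝ) := by
  have hQ := hP.2
  have hP := hP.1
  rw [mem_segmentOf_run hn] at hP hQ
  by_cases hs : M.slope i = M.slope j
  · rw [lowMarks, highMarks, if_pos hs, if_pos hs]
    constructor
    · rintro t (rfl | rfl) <;> simp only [val_left] <;> push_cast <;> linarith
    · rintro t (rfl | rfl) <;> simp only [val_right] <;> push_cast <;> linarith
  · have h := (two_mul_eq_meet hd hs P.1).1 (hP.2.2.symm.trans hQ.2.2)
    rw [lowMarks, highMarks, if_neg hs, if_neg hs]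
    exact ⟨by rintro t rfl; exact h.ge, by rintro t rfl; exact h.le⟩

theorem exists_low {M : RunFamily Λ} (hd : M.Diagonal) (hn : M.Inhab) {i j : Λ}
    (h : (segmentOf (M.run i) ∩ segmentOf (M.run j)).Nonempty) :
    ∃ P ∈ segmentOf (M.run i) ∩ segmentOf (M.run j), ∃ t ∈ M.lowMarks i j,
      2 * P.1 = M.val t := by
  obtain ⟨P, hP, hQ⟩ := h
  rw [mem_segmentOf_run hn] at hP hQ
  by_cases hs : M.slope i = M.slope j
  · have hc : (M.icpt i : ℝ) = M.icpt j := by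
      have := hP.2.2.symm.trans hQ.2.2
      rw [hs] at this
      exact add_right_cancel this
    rcases le_total (M.left i) (M.left j) with hl | hl
    · refine ⟨(M.left j, M.icpt j + M.slope j * M.left j), ⟨?_, ?_⟩, .left j, ?_, by simp⟩
      · rw [mem_segmentOf_run hn]
        exact ⟨Int.cast_le.2 hl, hQ.1.trans hP.2.1, by rw [hc, hs]⟩
      · rw [mem_segmentOf_run hn]
        exact ⟨le_rfl, Int.cast_le.2 (hn j), rfl⟩
      · simp [lowMarks, hs]
    · refine ⟨(M.left i, M.icpt i + M.slope i * M.left i), ⟨?_, ?_⟩, .left i, ?_, by simp⟩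
      · rw [mem_segmentOf_run hn]
        exact ⟨le_rfl, Int.cast_le.2 (hn i), rfl⟩
      · rw [mem_segmentOf_run hn]
        exact ⟨Int.cast_le.2 hl, hP.1.trans hQ.2.1, by rw [hc, hs]⟩
      · simp [lowMarks, hs]
  · refine ⟨P, ⟨(mem_segmentOf_run hn).2 hP, (mem_segmentOf_run hn).2 hQ⟩, .meet i j, ?_,
      (two_mul_eq_meet hd hs P.1).1 (hP.2.2.symm.trans hQ.2.2)⟩
    simp [lowMarks, hs]

theorem exists_high {M : RunFamily Λ} (hd : M.Diagonal) (hn : M.Inhab) {i j : Λ}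
    (h : (segmentOf (M.run i) ∩ segmentOf (M.run j)).Nonempty) :
    ∃ P ∈ segmentOf (M.run i) ∩ segmentOf (M.run j), ∃ t ∈ M.highMarks i j,
      2 * P.1 = M.val t := by
  obtain ⟨P, hP, hQ⟩ := h
  rw [mem_segmentOf_run hn] at hP hQ
  by_cases hs : M.slope i = M.slope j
  · have hc : (M.icpt i : ℝ) = M.icpt j := by
      have := hP.2.2.symm.trans hQ.2.2
      rw [hs] at this
      exact add_right_cancel this
    rcases le_total (M.right i) (M.right j) with hl | hl
    · refine ⟨(M.right i, M.icpt i + M.slope i * M.right i), ⟨?_, ?_⟩, .right i, ?_, by simp⟩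
      · rw [mem_segmentOf_run hn]
        exact ⟨Int.cast_le.2 (hn i), le_rfl, rfl⟩
      · rw [mem_segmentOf_run hn]
        exact ⟨hQ.1.trans hP.2.1, Int.cast_le.2 hl, by rw [hc, hs]⟩
      · simp [highMarks, hs]
    · refine ⟨(M.right j, M.icpt j + M.slope j * M.right j), ⟨?_, ?_⟩, .right j, ?_, by simp⟩
      · rw [mem_segmentOf_run hn]
        exact ⟨hP.1.trans hQ.2.1, Int.cast_le.2 hl, by rw [hc, hs]⟩
      · rw [mem_segmentOf_run hn]
        exact ⟨Int.cast_le.2 (hn j), le_rfl, rfl⟩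
      · simp [highMarks, hs]
  · refine ⟨P, ⟨(mem_segmentOf_run hn).2 hP, (mem_segmentOf_run hn).2 hQ⟩, .meet i j, ?_,
      (two_mul_eq_meet hd hs P.1).1 (hP.2.2.symm.trans hQ.2.2)⟩
    simp [highMarks, hs]

/-- The abscissae of an intersection fill an interval whose ends are attained at a low mark and at a
high mark. Strict precedence is therefore witnessed by one high mark of the first intersection and
one low mark of the second. -/
theorem crossBefore_run_iff {M : RunFamily Λ} (hd : M.Diagonal) (hn : M.Inhab) (i j k : Λ) :
    CrossBefore (M.run i) (M.run j) (M.run k) ↔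
      Cross (M.run i) (M.run j) ∧ Cross (M.run i) (M.run k) ∧
        ∃ s ∈ M.highMarks i j, ∃ t ∈ M.lowMarks i k, ¬ M.val t ≤ M.val s := by
  refine and_congr_right fun h1 => and_congr_right fun h2 => ⟨fun h => ?_, ?_⟩
  · obtain ⟨P, hP, s, hs, hPs⟩ := exists_high hd hn h1.2
    obtain ⟨Q, hQ, t, ht, hQt⟩ := exists_low hd hn h2.2
    refine ⟨s, hs, t, ht, fun hle => ?_⟩
    have h3 := h P hP Q hQ
    have h4 : (M.val t : ℝ) ≤ M.val s := Int.cast_le.2 hle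
    linarith
  · rintro ⟨s, hs, t, ht, hlt⟩ P hP Q hQ
    have h3 := (le_of_mem_inter hd hn hP).2 s hs
    have h4 := (le_of_mem_inter hd hn hQ).1 t ht
    have h5 : (M.val s : ℝ) < M.val t := by exact_mod_cast not_le.1 hlt
    linarith

section Transfer
variable {M N : RunFamily Λ}

theorem SamePattern.diagonal (h : SamePattern M N) (hd : M.Diagonal) : N.Diagonal :=
  fun i => h.slope i ▸ hd i

theorem SamePattern.run_subset_run (h : SamePattern M N) (hd : M.Diagonal) (hM : M.Inhab)
    (hN : N.Inhab) (i j : Λ) : M.run i ⊆ M.run j ↔ N.run i ⊆ N.run j := by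
  rw [run_subset_run_iff hd hM, run_subset_run_iff (h.diagonal hd) hN]
  simp only [h.val, h.slope]

theorem SamePattern.run_eq_run (h : SamePattern M N) (hd : M.Diagonal) (hM : M.Inhab)
    (hN : N.Inhab) (i j : Λ) : M.run i = M.run j ↔ N.run i = N.run j := by
  simp only [Set.Subset.antisymm_iff, h.run_subset_run hd hM hN]

theorem SamePattern.hasSlope_run (h : SamePattern M N) (hM : M.Inhab)
    (hN : N.Inhab) (i : Λ) (τ : ℤ) : HasSlope (M.run i) τ ↔ HasSlope (N.run i) τ := by
  rw [hasSlope_run_iff hM, hasSlope_run_iff hN, h.val, h.slope]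

theorem SamePattern.cross_run (h : SamePattern M N) (hd : M.Diagonal) (hM : M.Inhab)
    (hN : N.Inhab) (i j : Λ) : Cross (M.run i) (M.run j) ↔ Cross (N.run i) (N.run j) := by
  rw [Cross, Cross, inter_nonempty_iff hd hM, inter_nonempty_iff (h.diagonal hd) hN, ne_eq, ne_eq,
    h.run_eq_run hd hM hN]
  simp only [h.val, h.slope]

theorem SamePattern.crossBefore_run (h : SamePattern M N) (hd : M.Diagonal) (hM : M.Inhab)
    (hN : N.Inhab) (i j k : Λ) :
    CrossBefore (M.run i) (M.run j) (M.run k) ↔ CrossBefore (N.run i) (N.run j) (N.run k) := by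
  rw [crossBefore_run_iff hd hM, crossBefore_run_iff (h.diagonal hd) hN, h.cross_run hd hM hN,
    h.cross_run hd hM hN]
  simp only [h.val, highMarks, lowMarks, h.slope]

end Transfer

/-! ### Diagonals as maximal members of a family. -/

/-- The family consists of runs in `I` that between them contain all runs in `I`. -/
structure Dominates (M : RunFamily Λ) (I : Set (ℤ × ℤ)) : Prop where
  diagonal : M.Diagonal
  inhab : M.Inhab
  subset : ∀ i, M.run i ⊆ I
  exists_superset : ∀ E, IsRun E → E ⊆ I → ∃ i, E ⊆ M.run i

theorem Dominates.isDiagonal_run_iff {M : RunFamily Λ} {I : Set (ℤ × ℤ)} (h : M.Dominates I)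
    (i : Λ) : IsDiagonal I (M.run i) ↔ ∀ j, M.run i ⊆ M.run j → M.run j ⊆ M.run i := by
  constructor
  · intro hi j hj
    exact hi.2 ⟨isRun_lineRun (h.diagonal j) (h.inhab j), h.subset j⟩ hj
  · intro hi
    refine ⟨⟨isRun_lineRun (h.diagonal i) (h.inhab i), h.subset i⟩, fun E hE hiE => ?_⟩
    obtain ⟨j, hj⟩ := h.exists_superset E hE.1 hE.2
    exact hj.trans (hi j (hiE.trans hj))

theorem Dominates.exists_eq_run {M : RunFamily Λ} {I : Set (ℤ × ℤ)} (h : M.Dominates I)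
    {D : Set (ℤ × ℤ)} (hD : IsDiagonal I D) : ∃ i, D = M.run i := by
  obtain ⟨i, hi⟩ := h.exists_superset D hD.1.1 hD.1.2
  exact ⟨i, hi.antisymm
    (hD.2 ⟨isRun_lineRun (h.diagonal i) (h.inhab i), h.subset i⟩ hi)⟩

/-- The bijection sends a diagonal to the run with the same index in the other family. The choice of
index is harmless, because equality of runs is itself decided by the pattern. -/
theorem SamePattern.combEquiv_of_dominates {M N : RunFamily Λ} (h : SamePattern M N)
    {I J : Set (ℤ × ℤ)} (hI : M.Dominates I) (hJ : N.Dominates J) : CombEquiv I J := by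
  have hdiag : ∀ i, IsDiagonal I (M.run i) ↔ IsDiagonal J (N.run i) := fun i => by
    rw [hI.isDiagonal_run_iff, hJ.isDiagonal_run_iff]
    simp only [h.run_subset_run hI.diagonal hI.inhab hJ.inhab]
  have heq := h.run_eq_run hI.diagonal hI.inhab hJ.inhab
  choose f hf using fun D : {D // IsDiagonal I D} => hI.exists_eq_run D.2
  choose g hg using fun D : {D // IsDiagonal J D} => hJ.exists_eq_run D.2
  refine ⟨⟨fun D => ⟨N.run (f D), (hdiag _).1 (hf D ▸ D.2)⟩,
    fun D => ⟨M.run (g D), (hdiag _).2 (hg D ▸ D.2)⟩, fun D => ?_, fun D => ?_⟩, ?_, ?_, ?_⟩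
  · apply Subtype.ext
    have h1 := hg ⟨N.run (f D), (hdiag _).1 (hf D ▸ D.2)⟩
    exact (((heq _ _).2 h1).symm).trans (hf D).symm
  · apply Subtype.ext
    have h1 := hf ⟨M.run (g D), (hdiag _).2 (hg D ▸ D.2)⟩
    exact (((heq _ _).1 h1).symm).trans (hg D).symm
  · intro D σ _
    conv_lhs => rw [hf D]
    exact h.hasSlope_run hI.inhab hJ.inhab _ _
  · intro D E
    conv_lhs => rw [hf D, hf E]
    exact h.cross_run hI.diagonal hI.inhab hJ.inhab _ _
  · intro D E F
    conv_lhs => rw [hf D, hf E, hf F]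
    exact h.crossBefore_run hI.diagonal hI.inhab hJ.inhab _ _ _

/-! ### Merging touching runs into diagonals. -/

/-- Two nonempty runs on one line that overlap or follow each other without a gap. -/
def Touch (M : RunFamily Λ) (i j : Λ) : Prop :=
  M.left i ≤ M.right i ∧ M.left j ≤ M.right j ∧ M.slope i = M.slope j ∧ M.icpt i = M.icpt j ∧
    M.left j ≤ M.right i + 1 ∧ M.left i ≤ M.right j + 1

/-- Two runs that are joined by a chain of touching runs. -/
def Linked (M : RunFamily Λ) : Λ → Λ → Prop := Relation.ReflTransGen M.Touch

theorem Touch.symm {M : RunFamily Λ} {i j : Λ} (h : M.Touch i j) : M.Touch j i :=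
  ⟨h.2.1, h.1, h.2.2.1.symm, h.2.2.2.1.symm, h.2.2.2.2.2, h.2.2.2.2.1⟩

theorem Linked.symm {M : RunFamily Λ} {i j : Λ} (h : M.Linked i j) : M.Linked j i := by
  induction h with
  | refl => exact Relation.ReflTransGen.refl
  | tail _ h ih => exact Relation.ReflTransGen.head h.symm ih

theorem Linked.line {M : RunFamily Λ} {i j : Λ} (h : M.Linked i j) :
    M.slope i = M.slope j ∧ M.icpt i = M.icpt j := by
  induction h with
  | refl => exact ⟨rfl, rfl⟩
  | tail _ h ih => exact ⟨ih.1.trans h.2.2.1, ih.2.trans h.2.2.2.1⟩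

theorem touch_iff {M : RunFamily Λ} (hd : M.Diagonal) (i j : Λ) :
    M.Touch i j ↔ M.val (.left i) ≤ M.val (.right i) ∧ M.val (.left j) ≤ M.val (.right j) ∧
      M.slope i = M.slope j ∧
      (M.val (.meet i j) ≤ M.val (.meet i i) ∧ M.val (.meet i i) ≤ M.val (.meet i j)) ∧
      M.val (.left j) ≤ M.val (.next i) ∧ M.val (.left i) ≤ M.val (.next j) := by
  have hc : (M.val (.meet i j) ≤ M.val (.meet i i) ∧ M.val (.meet i i) ≤ M.val (.meet i j)) ↔
      M.icpt i = M.icpt j := by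
    simp only [val_meet]
    rcases hd i with h | h <;> rw [h] <;> omega
  rw [hc, Touch]
  simp only [val_left, val_right, val_next]
  omega

/-- Touching is a comparison of marks; the marks `next` are needed precisely here, for runs that
follow each other without overlap. -/
theorem SamePattern.linked {M N : RunFamily Λ} (h : SamePattern M N) (hd : M.Diagonal) :
    M.Linked = N.Linked := by
  have : M.Touch = N.Touch := by
    ext i j
    rw [touch_iff hd, touch_iff (h.diagonal hd)]
    simp only [h.val, h.slope]
  rw [Linked, Linked, this]

/-- `α` and `β` select, among the runs linked to a given one, one that begins first and one that
ends last. -/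
def Extremal (M : RunFamily Λ) (α β : Λ → Λ) : Prop :=
  ∀ i, M.Linked i (α i) ∧ M.Linked i (β i) ∧
    ∀ j, M.Linked i j → M.left (α i) ≤ M.left j ∧ M.right j ≤ M.right (β i)

theorem exists_extremal [Finite Λ] (M : RunFamily Λ) : ∃ α β, M.Extremal α β := by
  have hα : ∀ i, ∃ a, M.Linked i a ∧ ∀ j, M.Linked i j → M.left a ≤ M.left j := fun i => by
    obtain ⟨a, ha, h⟩ := Set.exists_min_image {j | M.Linked i j} M.left (Set.toFinite _)
      ⟨i, Relation.ReflTransGen.refl⟩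
    exact ⟨a, ha, h⟩
  have hβ : ∀ i, ∃ a, M.Linked i a ∧ ∀ j, M.Linked i j → M.right j ≤ M.right a := fun i => by
    obtain ⟨a, ha, h⟩ := Set.exists_max_image {j | M.Linked i j} M.right (Set.toFinite _)
      ⟨i, Relation.ReflTransGen.refl⟩
    exact ⟨a, ha, h⟩
  choose α h1 h2 using hα
  choose β h3 h4 using hβ
  exact ⟨α, β, fun i => ⟨h1 i, h3 i, fun j hj => ⟨h2 i j hj, h4 i j hj⟩⟩⟩

theorem SamePattern.extremal {M N : RunFamily Λ} (h : SamePattern M N) (hd : M.Diagonal)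
    {α β : Λ → Λ} (he : M.Extremal α β) : N.Extremal α β := by
  intro i
  obtain ⟨h1, h2, h3⟩ := he i
  rw [← h.linked hd]
  refine ⟨h1, h2, fun j hj => ?_⟩
  have h4 := h3 j hj
  have h5 := h.val (.left (α i)) (.left j)
  have h6 := h.val (.right j) (.right (β i))
  simp only [val_left, val_right] at h5 h6
  omega

/-- The members with index in `S`, extended to the ends of the selected runs. -/
def merge (M : RunFamily Λ) (α β : Λ → Λ) (S : Set Λ) : RunFamily S where
  slope i := M.slope i
  icpt i := M.icpt i
  left i := M.left (α i)
  right i := M.right (β i)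

/-- The run family fills `I`, and two diagonally adjacent points of `I` lie on
runs of the family in the direction of their adjacency. -/
structure Fills (M : RunFamily Λ) (I : Set (ℤ × ℤ)) : Prop where
  diagonal : M.Diagonal
  mem_iff : ∀ z, z ∈ I ↔ ∃ i, z ∈ M.run i
  adj : ∀ x y τ : ℤ, (τ = 1 ∨ τ = -1) → (x, y) ∈ I → (x + 1, y + τ) ∈ I →
    ∃ i j, M.slope i = τ ∧ M.slope j = τ ∧ (x, y) ∈ M.run i ∧ (x + 1, y + τ) ∈ M.run j

/-- A discrete intermediate value argument: if no linked run covered `x`, every run in the chain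
would end before `x`, since each next one starts at most one place after its predecessor ends. -/
theorem Linked.exists_mem {M : RunFamily Λ} {i j : Λ} (h : M.Linked i j)
    {x : ℤ} (hx : M.left i ≤ x) (hx' : x ≤ M.right j) :
    ∃ k, M.Linked i k ∧ M.left k ≤ x ∧ x ≤ M.right k := by
  by_contra! hcon
  have key : ∀ k, M.Linked i k → M.right k < x := by
    intro k hk
    induction hk with
    | refl => exact hcon i Relation.ReflTransGen.refl hx
    | tail h1 h2 ih =>
      refine hcon _ (h1.tail h2) ?_
      have := h2.2.2.2.2.1
      omega
  exact absurd (key j h) (by omega)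

theorem Fills.dominates_merge {M : RunFamily Λ} {I : Set (ℤ × ℤ)} (h : M.Fills I)
    {α β : Λ → Λ} (he : M.Extremal α β) :
    (M.merge α β {i | M.left i ≤ M.right i}).Dominates I := by
  have hsub : ∀ i : {i | M.left i ≤ M.right i}, ∀ j, M.Linked i j →
      M.run j ⊆ (M.merge α β {i | M.left i ≤ M.right i}).run i := by
    rintro ⟨i, hi⟩ j hij ⟨x, y⟩ ⟨h1, h2, h3⟩
    obtain ⟨-, -, he⟩ := he i
    refine ⟨(he j hij).1.trans h1, h2.trans (he j hij).2, ?_⟩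
    simp only [merge, hij.line.1, hij.line.2]
    exact h3
  have hne : ∀ {z i}, z ∈ M.run i → M.left i ≤ M.right i := fun hz => hz.1.trans hz.2.1
  refine ⟨fun i => h.diagonal i, fun i => ?_, fun i => ?_, fun E hE hEI => ?_⟩
  · have h1 := (he i).2.2 i Relation.ReflTransGen.refl
    have h2 : M.left i ≤ M.right i := i.2
    simp only [merge]
    omega
  · rintro ⟨x, y⟩ ⟨h1, h2, h3⟩
    obtain ⟨i, hi⟩ := i
    simp only [Set.mem_ofPred_eq] at hi
    simp only [merge] at h1 h2 h3
    obtain ⟨l1, l2, l3⟩ := he i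
    obtain ⟨k, hk, hk1, hk2⟩ := Linked.exists_mem (Relation.ReflTransGen.trans l1.symm l2) h1 h2
    refine (h.mem_iff _).2 ⟨k, hk1, hk2, ?_⟩
    have := Linked.line (Relation.ReflTransGen.trans l1 hk)
    rw [← this.1, ← this.2]
    exact h3
  · obtain ⟨σ, c, a, b, hσ, hab, rfl⟩ := hE.exists_lineRun
    rcases hab.eq_or_lt with rfl | hlt
    · obtain ⟨i, hi⟩ := (h.mem_iff (a, c + σ * a)).1 (hEI ⟨le_rfl, le_rfl, rfl⟩)
      refine ⟨⟨i, hne hi⟩, ?_⟩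
      rintro ⟨x, y⟩ ⟨h1, h2, h3⟩
      obtain rfl : x = a := le_antisymm h2 h1
      simp only at h3
      subst h3
      exact hsub ⟨i, hne hi⟩ i Relation.ReflTransGen.refl hi
    -- A run with at least two points is climbed step by step. Each step stays on members of slope
    -- `σ`, which touch, so the whole run lies in one linked class.
    · have edge : ∀ x, a ≤ x → x < b → ∃ i j, M.slope i = σ ∧ M.slope j = σ ∧
          (x, c + σ * x) ∈ M.run i ∧ (x + 1, c + σ * (x + 1)) ∈ M.run j := by
        intro x h1 h2
        have e : c + σ * (x + 1) = c + σ * x + σ := by ring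
        rw [e]
        refine h.adj x _ σ hσ (hEI ⟨h1, h2.le, rfl⟩) (hEI ⟨by simp only; omega, ?_, e.symm⟩)
        simp only; omega
      obtain ⟨i, -, hi, -, hi2, -⟩ := edge a le_rfl hlt
      have touch : ∀ {x j k}, M.slope j = σ → M.slope k = σ → (x, c + σ * x) ∈ M.run j →
          (x, c + σ * x) ∈ M.run k → M.Touch j k := by
        intro x j k hj hk h1 h2
        obtain ⟨a1, a2, a3⟩ := h1
        obtain ⟨b1, b2, b3⟩ := h2
        simp only [hj, hk] at a1 a2 a3 b1 b2 b3
        refine ⟨by omega, by omega, by rw [hj, hk], by omega, by omega, by omega⟩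
      have chain : ∀ n : ℕ, a + n ≤ b → ∃ j, M.Linked i j ∧ (a + n, c + σ * (a + n)) ∈ M.run j := by
        intro n
        induction n with
        | zero => intro _; exact ⟨i, Relation.ReflTransGen.refl, by simpa using hi2⟩
        | succ n ih =>
          intro hn
          push_cast at hn
          obtain ⟨j, hj, hj2⟩ := ih (by omega)
          obtain ⟨k, l, hk, hl, hk2, hl2⟩ := edge (a + n) (by omega) (by omega)
          have hjs : M.slope j = σ := hj.line.1.symm.trans hi
          refine ⟨l, (hj.tail (touch hjs hk hj2 hk2)).tail ?_, ?_⟩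
          · obtain ⟨a1, a2, a3⟩ := hk2
            obtain ⟨b1, b2, b3⟩ := hl2
            simp only [hk, hl] at a1 a2 a3 b1 b2 b3
            exact ⟨by omega, by omega, by rw [hk, hl], by linarith, by omega, by omega⟩
          · push_cast
            rw [← add_assoc]
            exact hl2
      refine ⟨⟨i, hne hi2⟩, ?_⟩
      rintro ⟨x, y⟩ ⟨h1, h2, h3⟩
      simp only at h1 h2 h3
      obtain ⟨j, hj, hj2⟩ := chain (x - a).toNat (by omega)
      have e : a + ((x - a).toNat : ℤ) = x := by omega
      rw [e, ← h3] at hj2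
      exact hsub ⟨i, hne hi2⟩ j hj hj2

/-- One choice of extremal runs serves both families, and the marks of the merged families are among
the original marks, so the merged families again have the same pattern. -/
theorem SamePattern.combEquiv [Finite Λ] {M N : RunFamily Λ} (h : SamePattern M N)
    {I J : Set (ℤ × ℤ)} (hI : M.Fills I) (hJ : N.Fills J) : CombEquiv I J := by
  obtain ⟨α, β, he⟩ := M.exists_extremal
  have hS : {i | M.left i ≤ M.right i} = {i | N.left i ≤ N.right i} := by
    ext i
    have := h.val (.left i) (.right i)
    simp only [val_left, val_right] at this
    simp only [Set.mem_ofPred_eq]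
    omega
  have hN := hJ.dominates_merge (h.extremal hI.diagonal he)
  rw [← hS] at hN
  refine SamePattern.combEquiv_of_dominates (M := M.merge α β {i | M.left i ≤ M.right i})
    (N := N.merge α β {i | M.left i ≤ M.right i})
    ⟨fun i => h.slope i, fun s t => ?_⟩ (hI.dominates_merge he) hN
  have key : ∀ s : Mark {i | M.left i ≤ M.right i}, ∃ s' : Mark Λ,
      (M.merge α β _).val s = M.val s' ∧ (N.merge α β _).val s = N.val s' := by
    rintro (i | i | i | ⟨i, j⟩)
    · exact ⟨.left (α i), rfl, rfl⟩
    · exact ⟨.right (β i), rfl, rfl⟩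
    · exact ⟨.next (β i), rfl, rfl⟩
    · exact ⟨.meet i j, rfl, rfl⟩
  obtain ⟨s', h1, h2⟩ := key s
  obtain ⟨t', h3, h4⟩ := key t
  rw [h1, h2, h3, h4]
  exact h.val s' t'

end RunFamily
-- Sequences with few changes of increment, and their sign changes.
/-- Outside `S`, consecutive increments of `u` agree (as far as position `L`). -/
def LinearOff (L : ℕ) (S : Finset ℕ) (u : ℕ → ℤ) : Prop :=
  ∀ k, k + 2 ≤ L → k ∉ S → u (k + 2) - u (k + 1) = u (k + 1) - u k

/-- Up to position `L`, the increment of `u` changes at most `N` times. -/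
def Tame (L N : ℕ) (u : ℕ → ℤ) : Prop := ∃ S : Finset ℕ, S.card ≤ N ∧ LinearOff L S u

theorem Tame.mono {L N N' : ℕ} {u : ℕ → ℤ} (h : Tame L N u) (hN : N ≤ N') : Tame L N' u :=
  let ⟨S, hS, hu⟩ := h
  ⟨S, hS.trans hN, hu⟩

theorem Tame.of_pair {L N M : ℕ} {u v w : ℕ → ℤ} (hu : Tame L N u) (hv : Tame L M v)
    (h : ∀ k, u (k + 2) - u (k + 1) = u (k + 1) - u k → v (k + 2) - v (k + 1) = v (k + 1) - v k →
      w (k + 2) - w (k + 1) = w (k + 1) - w k) : Tame L (N + M) w := by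
  obtain ⟨S, hS, hu⟩ := hu
  obtain ⟨T, hT, hv⟩ := hv
  refine ⟨S ∪ T, (Finset.card_union_le _ _).trans (add_le_add hS hT), fun k hk hkS => ?_⟩
  simp only [Finset.mem_union, not_or] at hkS
  exact h k (hu k hk hkS.1) (hv k hk hkS.2)

theorem Tame.sub {L N M : ℕ} {u v : ℕ → ℤ} (hu : Tame L N u) (hv : Tame L M v) :
    Tame L (N + M) (fun k => u k - v k) :=
  hu.of_pair hv fun k h1 h2 => by linarith

theorem Tame.const_mul {L N : ℕ} {u : ℕ → ℤ} (hu : Tame L N u) (c : ℤ) :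
    Tame L N (fun k => c * u k) := by
  obtain ⟨S, hS, hu⟩ := hu
  exact ⟨S, hS, fun k hk hkS => by linear_combination c * hu k hk hkS⟩

theorem Tame.add_const {L N : ℕ} {u : ℕ → ℤ} (hu : Tame L N u) (c : ℤ) :
    Tame L N (fun k => u k + c) := by
  obtain ⟨S, hS, hu⟩ := hu
  exact ⟨S, hS, fun k hk hkS => by linear_combination hu k hk hkS⟩

/-- The positions below `L` at which the sign of `u` changes. -/
def signChanges (L : ℕ) (u : ℕ → ℤ) : Finset ℕ :=
  (Finset.range L).filter fun k => ¬ (u k ≤ 0 ↔ u (k + 1) ≤ 0)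

theorem Tame.card_signChanges_le {L N : ℕ} {u : ℕ → ℤ} (hu : Tame L N u) :
    (signChanges L u).card ≤ N + 1 := by
  obtain ⟨S, hS, hu⟩ := hu
  -- The extra summand is 1 when `u` is heading towards the other sign. A crossing leaves `u`
  -- heading away, so without a change of increment a crossing only spends this unit. Each position
  -- in `S` raises the total by at most one.
  have key : ∀ n, n + 1 ≤ L → (signChanges (n + 1) u).card +
      (if (u (n + 1) ≤ 0 ∧ u n < u (n + 1)) ∨ (0 < u (n + 1) ∧ u (n + 1) < u n) then 1 else 0) ≤
      (S.filter (· < n)).card + 1 := by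
    intro n
    induction n with
    | zero =>
      intro _
      have h : (signChanges (0 + 1) u).card = if ¬ (u 0 ≤ 0 ↔ u 1 ≤ 0) then 1 else 0 := by
        rw [signChanges, Finset.range_one, Finset.filter_singleton]
        split_ifs <;> simp
      rw [h]
      simp only [zero_add]
      split_ifs <;> omega
    | succ n ih =>
      intro hn
      have h := ih (by omega)
      have h1 : (signChanges (n + 1 + 1) u).card = (signChanges (n + 1) u).card +
          if ¬ (u (n + 1) ≤ 0 ↔ u (n + 1 + 1) ≤ 0) then 1 else 0 := by
        rw [signChanges, Finset.range_add_one, Finset.filter_insert]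
        split_ifs
        · rfl
        · rw [Finset.card_insert_of_notMem (by simp)]; rfl
      have h2 : (S.filter (· < n + 1)).card = (S.filter (· < n)).card +
          if n ∈ S then 1 else 0 := by
        split_ifs with hnS
        · rw [← Finset.card_insert_of_notMem (a := n) (s := S.filter (· < n)) (by simp)]
          congr 1
          ext k
          simp only [Finset.mem_filter, Finset.mem_insert]
          constructor
          · rintro ⟨hk, hk'⟩
            rcases eq_or_ne k n with rfl | hne
            · exact Or.inl rfl
            · exact Or.inr ⟨hk, by omega⟩
          · rintro (rfl | ⟨hk, hk'⟩)
            · exact ⟨hnS, by omega⟩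
            · exact ⟨hk, by omega⟩
        · rw [add_zero]
          congr 1
          ext k
          simp only [Finset.mem_filter]
          refine and_congr_right fun hk => ?_
          have : k ≠ n := fun e => hnS (e ▸ hk)
          omega
      rw [h1, h2]
      by_cases hnS : n ∈ S
      · simp only [hnS, if_true]
        split_ifs at h ⊢ <;> omega
      · have h3 := hu n (by omega) hnS
        simp only [hnS, if_false]
        have e : n + 1 + 1 = n + 2 := rfl
        rw [e]
        split_ifs at h ⊢ <;> omega
  rcases Nat.eq_zero_or_pos L with rfl | hL
  · simp [signChanges]
  · obtain ⟨n, rfl⟩ : ∃ n, L = n + 1 := ⟨L - 1, by omega⟩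
    have h1 := key n le_rfl
    have h2 := Finset.card_filter_le S (· < n)
    omega

theorem Tame.max {L N M : ℕ} {u v : ℕ → ℤ} (hu : Tame L N u) (hv : Tame L M v) :
    Tame L (3 * (N + M) + 2) (fun k => max (u k) (v k)) := by
  have hC := (hu.sub hv).card_signChanges_le
  obtain ⟨S, hS, hu⟩ := hu
  obtain ⟨T, hT, hv⟩ := hv
  set C := signChanges L (fun k => u k - v k) with hCdef
  -- Removing `C` and its shift makes the same sequence the larger one at `k`, `k + 1` and `k + 2`.
  -- The count is `N + M` plus twice the `N + M + 1` sign changes of the difference.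
  refine ⟨(S ∪ T) ∪ (C ∪ C.image (· - 1)), ?_, fun k hk hkS => ?_⟩
  · have h1 := Finset.card_union_le (S ∪ T) (C ∪ C.image (· - 1))
    have h2 := Finset.card_union_le S T
    have h3 := Finset.card_union_le C (C.image (· - 1))
    have h4 := Finset.card_image_le (s := C) (f := (· - 1))
    omega
  · simp only [Finset.mem_union, Finset.mem_image, not_or, not_exists, not_and] at hkS
    obtain ⟨⟨h1, h2⟩, h3, h4⟩ := hkS
    have h5 : k + 1 ∉ C := fun h => h4 _ h (by omega)
    simp only [hCdef, signChanges, Finset.mem_filter, Finset.mem_range, not_and, not_not] at h3 h5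
    have h3 := h3 (by omega)
    have h5 := h5 (by omega)
    have h6 := hu k hk h1
    have h7 := hv k hk h2
    simp only [add_assoc, Nat.reduceAdd] at h3 h5
    beta_reduce
    omega

theorem Tame.min {L N M : ℕ} {u v : ℕ → ℤ} (hu : Tame L N u) (hv : Tame L M v) :
    Tame L (3 * (N + M) + 2) (fun k => min (u k) (v k)) := by
  have h := ((hu.const_mul (-1)).max (hv.const_mul (-1))).const_mul (-1)
  convert h using 2 with k
  omega

-- When the pattern changes, some pair of marks changes order, which is a sign change of their
-- difference; the bound is a union bound over pairs.
open Classical in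
theorem RunFamily.card_not_samePattern_le {Λ : Type*} [Fintype Λ] {L N : ℕ}
    (M : ℕ → RunFamily Λ) (hslope : ∀ k i, (M k).slope i = (M 0).slope i)
    (hval : ∀ s, Tame L N fun k => (M k).val s) :
    ((Finset.range L).filter fun k => ¬ SamePattern (M k) (M (k + 1))).card ≤
      Fintype.card (Mark Λ × Mark Λ) * (N + N + 1) := by
  calc _ ≤ ((Finset.univ : Finset (Mark Λ × Mark Λ)).biUnion fun st =>
        signChanges L fun k => (M k).val st.1 - (M k).val st.2).card := by
        apply Finset.card_le_card
        intro k hk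
        rw [Finset.mem_filter] at hk
        obtain ⟨hk, hp⟩ := hk
        by_contra hcon
        refine hp ⟨fun i => by rw [hslope k, hslope (k + 1)], fun s t => ?_⟩
        simp only [Finset.mem_biUnion, Finset.mem_univ, true_and, not_exists, signChanges,
          Finset.mem_filter, hk, not_not] at hcon
        simpa [sub_nonpos] using hcon (s, t)
    _ ≤ Fintype.card (Mark Λ × Mark Λ) * (N + N + 1) := by
        apply Finset.card_biUnion_le_card_mul
        intro st _
        exact ((hval st.1).sub (hval st.2)).card_signChanges_le

/-! ### Functions without valleys, and pairs of positions with equal values. -/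

namespace RunFamily

/-- The family of runs, drawn in the plane of positions and values, is the graph of `f` on the
integers from `x` to `y`; each step of slope `±1` lies on one run, and the two ends
of a horizontal step lie on a rising and on a falling run. -/
structure Traces {Γ : Type*} (M : RunFamily Γ) (x y : ℤ) (f : ℤ → ℤ) : Prop where
  diagonal : M.Diagonal
  mem_iff : ∀ i v, (x ≤ i ∧ i ≤ y ∧ v = f i) ↔ ∃ P, (i, v) ∈ M.run P
  lipschitz : ∀ i, x ≤ i → i < y → f (i + 1) ≤ f i + 1 ∧ f i ≤ f (i + 1) + 1
  step : ∀ i, x ≤ i → i < y → f (i + 1) ≠ f i →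
    ∃ P, M.slope P = f (i + 1) - f i ∧ (i, f i) ∈ M.run P ∧ (i + 1, f (i + 1)) ∈ M.run P
  flat : ∀ i, x ≤ i → i < y → f (i + 1) = f i →
    (∃ P, M.slope P = 1 ∧ (i, f i) ∈ M.run P) ∧
      ∃ P, M.slope P = -1 ∧ (i + 1, f (i + 1)) ∈ M.run P

/-- The rising and the falling part of a function on the integers from `x` to `y` that has the
values `p` and `q` at the ends and no local minimum in between. -/
def tent (p q x y : ℤ) : RunFamily Bool where
  slope b := if b then 1 else -1
  icpt b := if b then p - x else q + y
  left b := if b then x else (q - p + x + y + 1) / 2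
  right b := if b then (q - p + x + y) / 2 else y

/-- Both lines bound `f` from above by the Lipschitz condition. Starting from `x`, `f` climbs until
it first fails to; there the rule forces a descent, and a descent, once begun, must continue to `y`.
-/
theorem eq_min_of_no_valley {f : ℤ → ℤ} {x y : ℤ}
    (hlip : ∀ i, x ≤ i → i < y → f (i + 1) ≤ f i + 1 ∧ f i ≤ f (i + 1) + 1)
    (hrule : ∀ i, x < i → i < y → f i = 1 + f (i - 1) ∨ f i = 1 + f (i + 1)) {i : ℤ}
    (hx : x ≤ i) (hy : i ≤ y) :
    f i = min (f x + (i - x)) (f y + (y - i)) := by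
  have up : ∀ n : ℕ, x + n ≤ y → f (x + n) ≤ f x + n := by
    intro n
    induction n with
    | zero => simp
    | succ n ih =>
      intro hn
      push_cast at hn ⊢
      have h1 := ih (by omega)
      have h2 := hlip (x + n) (by omega) (by omega)
      rw [← add_assoc]
      omega
  have down : ∀ n : ℕ, x ≤ y - n → f (y - n) ≤ f y + n := by
    intro n
    induction n with
    | zero => simp
    | succ n ih =>
      intro hn
      push_cast at hn ⊢
      have h1 := ih (by omega)
      have h2 := hlip (y - (n + 1)) (by omega) (by omega)
      have e : y - (n + 1 : ℤ) + 1 = y - n := by ring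
      rw [e] at h2
      omega
  have fall : ∀ n : ℕ, ∀ j, x ≤ j → j + n + 1 = y → f j = 1 + f (j + 1) → f j = f y + (y - j) := by
    intro n
    induction n with
    | zero =>
      intro j _ hj hf
      obtain rfl : y = j + 1 := by push_cast at hj; omega
      omega
    | succ n ih =>
      intro j hx hj hf
      push_cast at hj
      have h1 := hrule (j + 1) (by omega) (by omega)
      rw [add_sub_cancel_right] at h1
      have h2 := ih (j + 1) (by omega) (by omega) (by omega)
      omega
  have fall' : ∀ j, x ≤ j → j < y → f j = 1 + f (j + 1) → f j = f y + (y - j) := fun j h1 h2 h3 =>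
    fall (y - j - 1).toNat j h1 (by omega) h3
  have either : ∀ n : ℕ, x + n ≤ y →
      f (x + n) = f x + n ∨ f (x + n) = f y + (y - (x + n)) := by
    intro n
    induction n with
    | zero => simp
    | succ n ih =>
      intro hn
      push_cast at hn ⊢
      rw [← add_assoc]
      have h2 := hlip (x + n) (by omega) (by omega)
      have h4 := down (y - (x + n + 1)).toNat (by omega)
      have e : y - ((y - (x + n + 1)).toNat : ℤ) = x + n + 1 := by omega
      rw [e] at h4
      rcases ih (by omega) with h1 | h1
      · rcases (show x + n + 1 ≤ y by omega).eq_or_lt with h3 | h3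
        · right; rw [h3]; ring
        · rcases hrule (x + n + 1) (by omega) h3 with h5 | h5
          · left
            rw [add_sub_cancel_right] at h5
            omega
          · right
            exact fall' _ (by omega) h3 h5
      · right
        omega
  have h1 := up (i - x).toNat (by omega)
  have h2 := down (y - i).toNat (by omega)
  have h3 := either (i - x).toNat (by omega)
  have e1 : x + ((i - x).toNat : ℤ) = i := by omega
  have e2 : y - ((y - i).toNat : ℤ) = i := by omega
  rw [e1] at h1 h3
  rw [e2] at h2
  omega

theorem tent_traces {f : ℤ → ℤ} {x y : ℤ} (hxy : x ≤ y)
    (hlip : ∀ i, x ≤ i → i < y → f (i + 1) ≤ f i + 1 ∧ f i ≤ f (i + 1) + 1)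
    (hrule : ∀ i, x < i → i < y → f i = 1 + f (i - 1) ∨ f i = 1 + f (i + 1)) :
    (tent (f x) (f y) x y).Traces x y f := by
  have key := fun i => eq_min_of_no_valley hlip hrule (i := i)
  have hx := key x le_rfl hxy
  have hy := key y hxy le_rfl
  have hup : ∀ i v, (i, v) ∈ (tent (f x) (f y) x y).run true ↔
      x ≤ i ∧ i ≤ (f y - f x + x + y) / 2 ∧ v = f x - x + 1 * i := fun i v => Iff.rfl
  have hdown : ∀ i v, (i, v) ∈ (tent (f x) (f y) x y).run false ↔
      (f y - f x + x + y + 1) / 2 ≤ i ∧ i ≤ y ∧ v = f y + y + -1 * i := fun i v => Iff.rfl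
  refine ⟨?_, ?_, hlip, ?_, ?_⟩
  · rintro (b | b) <;> simp [tent]
  · intro i v
    rw [Bool.exists_bool, hup, hdown]
    constructor
    · rintro ⟨h1, h2, h3⟩
      have := key i h1 h2
      omega
    · intro h
      have h1 : x ≤ i ∧ i ≤ y := by omega
      have := key i h1.1 h1.2
      omega
  · intro i h1 h2 h3
    have h4 := key i h1 h2.le
    have h5 := key (i + 1) (by omega) (by omega)
    rw [Bool.exists_bool, hup, hdown, hup, hdown]
    have s1 : (tent (f x) (f y) x y).slope true = 1 := rfl
    have s2 : (tent (f x) (f y) x y).slope false = -1 := rfl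
    rw [s1, s2]
    have := hlip i h1 h2
    omega
  · intro i h1 h2 h3
    have h4 := key i h1 h2.le
    have h5 := key (i + 1) (by omega) (by omega)
    refine ⟨⟨true, rfl, ?_⟩, ⟨false, rfl, ?_⟩⟩
    · rw [hup]; omega
    · rw [hdown]; omega

/-- The union of two families. -/
def append {Γ Γ' : Type*} (M : RunFamily Γ) (N : RunFamily Γ') : RunFamily (Γ ⊕ Γ') where
  slope := Sum.elim M.slope N.slope
  icpt := Sum.elim M.icpt N.icpt
  left := Sum.elim M.left N.left
  right := Sum.elim M.right N.right

theorem Traces.append {Γ Γ' : Type*} {M : RunFamily Γ} {N : RunFamily Γ'} {x t y : ℤ}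
    {f : ℤ → ℤ} (hxt : x ≤ t) (hty : t ≤ y) (hM : M.Traces x t f) (hN : N.Traces t y f) :
    (M.append N).Traces x y f := by
  have hl : ∀ P, (M.append N).run (Sum.inl P) = M.run P := fun _ => rfl
  have hr : ∀ P, (M.append N).run (Sum.inr P) = N.run P := fun _ => rfl
  refine ⟨?_, ?_, ?_, ?_, ?_⟩
  · rintro (P | P)
    · exact hM.diagonal P
    · exact hN.diagonal P
  · intro i v
    rw [Sum.exists]
    simp only [hl, hr]
    rw [← hM.mem_iff, ← hN.mem_iff]
    omega
  · intro i h1 h2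
    rcases lt_or_ge i t with h | h
    · exact hM.lipschitz i h1 h
    · exact hN.lipschitz i h h2
  · intro i h1 h2 h3
    rcases lt_or_ge i t with h | h
    · obtain ⟨P, hP⟩ := hM.step i h1 h h3
      exact ⟨Sum.inl P, hP⟩
    · obtain ⟨P, hP⟩ := hN.step i h h2 h3
      exact ⟨Sum.inr P, hP⟩
  · intro i h1 h2 h3
    rcases lt_or_ge i t with h | h
    · obtain ⟨⟨P, hP⟩, Q, hQ⟩ := hM.flat i h1 h h3
      exact ⟨⟨Sum.inl P, hP⟩, Sum.inl Q, hQ⟩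
    · obtain ⟨⟨P, hP⟩, Q, hQ⟩ := hN.flat i h h2 h3
      exact ⟨⟨Sum.inr P, hP⟩, Sum.inr Q, hQ⟩

/-- The runs of pairs of positions at which a run of `M` and a run of `N` have equal values. -/
def pairing {Γ Γ' : Type*} (M : RunFamily Γ) (N : RunFamily Γ') : RunFamily (Γ × Γ') where
  slope P := N.slope P.2 * M.slope P.1
  icpt P := N.slope P.2 * (M.icpt P.1 - N.icpt P.2)
  left P := max (M.left P.1)
    (if N.slope P.2 * M.slope P.1 = 1 then
      N.left P.2 - N.slope P.2 * (M.icpt P.1 - N.icpt P.2)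
    else N.slope P.2 * (M.icpt P.1 - N.icpt P.2) - N.right P.2)
  right P := min (M.right P.1)
    (if N.slope P.2 * M.slope P.1 = 1 then
      N.right P.2 - N.slope P.2 * (M.icpt P.1 - N.icpt P.2)
    else N.slope P.2 * (M.icpt P.1 - N.icpt P.2) - N.left P.2)

theorem mem_run_pairing {Γ Γ' : Type*} {M : RunFamily Γ} {N : RunFamily Γ'} (hM : M.Diagonal)
    (hN : N.Diagonal) {P : Γ} {Q : Γ'} {i j : ℤ} :
    (i, j) ∈ (M.pairing N).run (P, Q) ↔ ∃ v, (i, v) ∈ M.run P ∧ (j, v) ∈ N.run Q := by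
  simp only [run, pairing, lineRun, Set.mem_ofPred_eq]
  constructor
  · rintro ⟨h1, h2, h3⟩
    refine ⟨M.icpt P + M.slope P * i, ?_⟩
    rcases hM P with h | h <;> rcases hN Q with h' | h' <;> simp only [h, h'] at * <;>
      norm_num at * <;> omega
  · rintro ⟨v, h1, h2⟩
    rcases hM P with h | h <;> rcases hN Q with h' | h' <;> simp only [h, h'] at * <;>
      norm_num at * <;> omega

/-- If neither function is flat at a diagonal step, both ends of the step lie on one paired run. If
both are flat, at their peaks, the two ends lie on different paired runs of the slope of the step;
this is why `Fills` allows two runs and why merging is needed. -/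
theorem Traces.fills_pairing {Γ Γ' : Type*} {M : RunFamily Γ} {N : RunFamily Γ'}
    {x y x' y' : ℤ} {f g : ℤ → ℤ} (hM : M.Traces x y f) (hN : N.Traces x' y' g) :
    (M.pairing N).Fills
      {z | x ≤ z.1 ∧ z.1 ≤ y ∧ x' ≤ z.2 ∧ z.2 ≤ y' ∧ f z.1 = g z.2} := by
  have hmem : ∀ {P Q i j}, (i, f i) ∈ M.run P → (j, g j) ∈ N.run Q → f i = g j →
      (i, j) ∈ (M.pairing N).run (P, Q) := fun h1 h2 h3 =>
    (mem_run_pairing hM.diagonal hN.diagonal).2 ⟨_, h1, h3 ▸ h2⟩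
  refine ⟨?_, ?_, ?_⟩
  · rintro ⟨P, Q⟩
    simp only [pairing]
    rcases hM.diagonal P with h | h <;> rcases hN.diagonal Q with h' | h' <;> simp [h, h']
  · rintro ⟨i, j⟩
    constructor
    · rintro ⟨h1, h2, h3, h4, h5⟩
      obtain ⟨P, hP⟩ := (hM.mem_iff i (f i)).1 ⟨h1, h2, rfl⟩
      obtain ⟨Q, hQ⟩ := (hN.mem_iff j (g j)).1 ⟨h3, h4, rfl⟩
      exact ⟨(P, Q), hmem hP hQ h5⟩
    · rintro ⟨⟨P, Q⟩, h⟩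
      obtain ⟨v, h1, h2⟩ := (mem_run_pairing hM.diagonal hN.diagonal).1 h
      obtain ⟨a1, a2, a3⟩ := (hM.mem_iff i v).2 ⟨P, h1⟩
      obtain ⟨b1, b2, b3⟩ := (hN.mem_iff j v).2 ⟨Q, h2⟩
      exact ⟨a1, a2, b1, b2, a3.symm.trans b3⟩
  · rintro i j τ hτ ⟨h1, h2, h3, h4, h5⟩ ⟨k1, k2, k3, k4, k5⟩
    simp only at h1 h2 h3 h4 h5 k1 k2 k3 k4 k5
    have hf := hM.lipschitz i h1 (by omega)
    rcases hτ with rfl | rfl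
    · by_cases hflat : f (i + 1) = f i
      · obtain ⟨⟨P, hP, hP'⟩, P₂, hP₂, hP₂'⟩ := hM.flat i h1 (by omega) hflat
        obtain ⟨⟨Q, hQ, hQ'⟩, Q₂, hQ₂, hQ₂'⟩ := hN.flat j h3 (by omega) (by omega)
        exact ⟨(P, Q), (P₂, Q₂), by simp [pairing, hP, hQ], by simp [pairing, hP₂, hQ₂],
          hmem hP' hQ' h5, hmem hP₂' hQ₂' k5⟩
      · obtain ⟨P, hP, hP1, hP2⟩ := hM.step i h1 (by omega) hflat
        obtain ⟨Q, hQ, hQ1, hQ2⟩ := hN.step j h3 (by omega) (by omega)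
        have hs : N.slope Q * M.slope P = 1 := by
          have : N.slope Q = M.slope P := by omega
          rcases hM.diagonal P with h | h <;> rw [this, h] <;> norm_num
        exact ⟨(P, Q), (P, Q), hs, hs, hmem hP1 hQ1 h5, hmem hP2 hQ2 k5⟩
    · rw [← sub_eq_add_neg] at k3 k4 k5 ⊢
      by_cases hflat : f (i + 1) = f i
      · obtain ⟨⟨P, hP, hP'⟩, P₂, hP₂, hP₂'⟩ := hM.flat i h1 (by omega) hflat
        obtain ⟨⟨Q, hQ, hQ'⟩, Q₂, hQ₂, hQ₂'⟩ :=
          hN.flat (j - 1) k3 (by omega) (by rw [sub_add_cancel]; omega)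
        rw [sub_add_cancel] at hQ₂'
        exact ⟨(P, Q₂), (P₂, Q), by simp [pairing, hP, hQ₂], by simp [pairing, hP₂, hQ],
          hmem hP' hQ₂' h5, hmem hP₂' hQ' k5⟩
      · obtain ⟨P, hP, hP1, hP2⟩ := hM.step i h1 (by omega) hflat
        obtain ⟨Q, hQ, hQ1, hQ2⟩ :=
          hN.step (j - 1) k3 (by omega) (by rw [sub_add_cancel]; omega)
        rw [sub_add_cancel] at hQ hQ2
        have hs : N.slope Q * M.slope P = -1 := by
          have : N.slope Q = -M.slope P := by omega
          rcases hM.diagonal P with h | h <;> rw [this, h] <;> norm_num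
        exact ⟨(P, Q), (P, Q), hs, hs, hmem hP1 hQ2 h5, hmem hP2 hQ1 k5⟩

/-! ### Families whose parameters vary tamely. -/

/-- Slopes are constant and the other parameters are tame. -/
structure TameFamily {Γ : Type*} (L N : ℕ) (M : ℕ → RunFamily Γ) : Prop where
  slope : ∀ k P, (M k).slope P = (M 0).slope P
  icpt : ∀ P, Tame L N fun k => (M k).icpt P
  left : ∀ P, Tame L N fun k => (M k).left P
  right : ∀ P, Tame L N fun k => (M k).right P

theorem TameFamily.val {Γ : Type*} {L N : ℕ} {M : ℕ → RunFamily Γ} (h : TameFamily L N M)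
    (s : Mark Γ) : Tame L (N + N) fun k => (M k).val s := by
  rcases s with P | P | P | ⟨P, Q⟩
  · exact ((h.left P).const_mul 2).mono (by omega)
  · exact ((h.right P).const_mul 2).mono (by omega)
  · exact (((h.right P).const_mul 2).add_const 2).mono (by omega)
  · have := ((h.icpt Q).sub (h.icpt P)).const_mul ((M 0).slope P)
    convert this using 2 with k
    rw [← h.slope k]
    rfl

theorem TameFamily.pairing {Γ Γ' : Type*} {L N : ℕ} {M : ℕ → RunFamily Γ}
    {M' : ℕ → RunFamily Γ'} (h : TameFamily L N M) (h' : TameFamily L N M') :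
    TameFamily L (12 * N + 2) fun k => (M k).pairing (M' k) := by
  have hc : ∀ P Q, Tame L (N + N)
      fun k => (M' k).slope Q * ((M k).icpt P - (M' k).icpt Q) := fun P Q => by
    convert ((h.icpt P).sub (h'.icpt Q)).const_mul ((M' 0).slope Q) using 3 with k
    exact h'.slope k Q
  refine ⟨?_, ?_, ?_, ?_⟩
  · rintro k ⟨P, Q⟩
    simp only [RunFamily.pairing]
    rw [h.slope k, h'.slope k]
  · rintro ⟨P, Q⟩
    exact (hc P Q).mono (by omega)
  · rintro ⟨P, Q⟩
    simp only [RunFamily.pairing]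
    refine ((h.left P).max (M := 3 * N) ?_).mono (by omega)
    by_cases hs : (M' 0).slope Q * (M 0).slope P = 1
    · simp only [h.slope _ P, h'.slope _ Q, hs, if_true]
      refine Tame.mono ((h'.left Q).sub ?_) (N := N + (N + N)) (by omega)
      simpa only [h'.slope _ Q] using hc P Q
    · simp only [h.slope _ P, h'.slope _ Q, hs, if_false]
      refine Tame.mono (Tame.sub ?_ (h'.right Q)) (N := N + N + N) (by omega)
      simpa only [h'.slope _ Q] using hc P Q
  · rintro ⟨P, Q⟩
    simp only [RunFamily.pairing]
    refine ((h.right P).min (M := 3 * N) ?_).mono (by omega)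
    by_cases hs : (M' 0).slope Q * (M 0).slope P = 1
    · simp only [h.slope _ P, h'.slope _ Q, hs, if_true]
      refine Tame.mono ((h'.right Q).sub ?_) (N := N + (N + N)) (by omega)
      simpa only [h'.slope _ Q] using hc P Q
    · simp only [h.slope _ P, h'.slope _ Q, hs, if_false]
      refine Tame.mono (Tame.sub ?_ (h'.left Q)) (N := N + N + N) (by omega)
      simpa only [h'.slope _ Q] using hc P Q

/-- The peak of a tent is a half-sum rounded to an integer. Rounding preserves constant increments
because `heven` makes the sum change by even amounts. -/
theorem tent_tameFamily {L N : ℕ} {S : Finset ℕ} (hS : S.card ≤ N) {p q x y : ℕ → ℤ}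
    (hp : LinearOff L S p) (hq : LinearOff L S q) (hx : LinearOff L S x) (hy : LinearOff L S y)
    (heven : ∀ k, k + 2 ≤ L → k ∉ S →
      2 ∣ (q (k + 1) - p (k + 1) + x (k + 1) + y (k + 1)) - (q k - p k + x k + y k)) :
    TameFamily L N fun k => tent (p k) (q k) (x k) (y k) := by
  refine ⟨fun _ _ => rfl, ?_, ?_, ?_⟩ <;> rintro (_ | _) <;> refine ⟨S, hS, fun k hk hkS => ?_⟩ <;>
    have h1 := hp k hk hkS <;> have h2 := hq k hk hkS <;> have h3 := hx k hk hkS <;>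
    have h4 := hy k hk hkS <;> have h5 := heven k hk hkS <;>
    simp only [tent, Bool.false_eq_true, if_false, if_true] <;> omega

theorem TameFamily.append {Γ Γ' : Type*} {L N : ℕ} {M : ℕ → RunFamily Γ}
    {M' : ℕ → RunFamily Γ'} (h : TameFamily L N M) (h' : TameFamily L N M') :
    TameFamily L N fun k => (M k).append (M' k) := by
  refine ⟨?_, ?_, ?_, ?_⟩
  · rintro k (P | P)
    · exact h.slope k P
    · exact h'.slope k P
  · rintro (P | P)
    · exact h.icpt P
    · exact h'.icpt P
  · rintro (P | P)
    · exact h.left P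
    · exact h'.left P
  · rintro (P | P)
    · exact h.right P
    · exact h'.right P

end RunFamily
-- Distances along a thread.
section Thread
variable {V : Type*} {G : SimpleGraph V} {u v : V} {p : G.Walk u v}

theorem IsThread.eq_of_getVert_eq (hp : IsThread G p) {i j : ℕ} (h0 : 0 < i) (hi : i < p.length)
    (hj : j ≤ p.length) (h : p.getVert i = p.getVert j) : i = j := by
  rcases hp.path_or_cycle with hp | ⟨rfl, hp⟩
  · exact hp.getVert_injOn hi.le hj h
  · rw [SimpleGraph.Walk.copy_rfl_rfl] at hp
    rcases Nat.eq_zero_or_pos j with rfl | hj0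
    · rw [SimpleGraph.Walk.getVert_zero, hp.getVert_endpoint_iff hi.le] at h
      omega
    · exact hp.getVert_injOn ⟨h0, hi.le⟩ ⟨hj0, hj⟩ h

theorem IsThread.getVert_sub_one_ne (hp : IsThread G p) {i : ℕ} (h0 : 0 < i)
    (hi : i < p.length) : p.getVert (i - 1) ≠ p.getVert (i + 1) := by
  rcases hp.path_or_cycle with hp | ⟨rfl, hp⟩
  · intro h
    have := hp.getVert_injOn (show i - 1 ≤ p.length by omega) (show i + 1 ≤ p.length by omega) h
    omega
  · rw [SimpleGraph.Walk.copy_rfl_rfl] at hp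
    exact hp.getVert_sub_one_ne_getVert_add_one hi.le

theorem IsThread.adj_iff (hp : IsThread G p) {i : ℕ} (h0 : 0 < i) (hi : i < p.length) (w : V) :
    G.Adj (p.getVert i) w ↔ w = p.getVert (i - 1) ∨ w = p.getVert (i + 1) := by
  have h1 : G.Adj (p.getVert i) (p.getVert (i - 1)) := by
    have := p.adj_getVert_succ (show i - 1 < p.length by omega)
    rw [Nat.sub_add_cancel h0] at this
    exact this.symm
  have h2 : G.Adj (p.getVert i) (p.getVert (i + 1)) := p.adj_getVert_succ hi
  have h3 : {p.getVert (i - 1), p.getVert (i + 1)} = G.neighborSet (p.getVert i) := by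
    have hc := hp.internal i h0 hi
    apply Set.eq_of_subset_of_ncard_le
    · rintro w (rfl | rfl)
      · exact h1
      · exact h2
    · rw [hc, Set.ncard_pair (hp.getVert_sub_one_ne h0 hi)]
    · exact Set.finite_of_ncard_ne_zero (by omega)
  rw [← SimpleGraph.mem_neighborSet, ← h3]
  rfl

theorem IsThread.card_getVert_eq_le [DecidableEq V] (hp : IsThread G p) (x : V) :
    ((Finset.range (p.length + 1)).filter fun k => p.getVert k = x).card ≤ 2 := by
  by_cases h : ∃ i, 0 < i ∧ i < p.length ∧ p.getVert i = x
  · obtain ⟨i, h0, hi, rfl⟩ := h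
    refine (Finset.card_le_card (t := {i}) fun k hk => ?_).trans (by simp)
    rw [Finset.mem_filter, Finset.mem_range] at hk
    rw [Finset.mem_singleton, hp.eq_of_getVert_eq h0 hi (by omega) hk.2.symm]
  · refine (Finset.card_le_card (t := {0, p.length}) fun k hk => ?_).trans Finset.card_le_two
    rw [Finset.mem_filter, Finset.mem_range] at hk
    rw [Finset.mem_insert, Finset.mem_singleton]
    by_contra hcon
    exact h ⟨k, by omega, by omega, hk.2⟩

theorem dist_le_dist_add_one {s x y : V} (h : G.Adj x y) :
    (G.dist s y : ℤ) ≤ G.dist s x + 1 ∧ (G.dist s x : ℤ) ≤ G.dist s y + 1 := by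
  have h1 := h.diff_dist_adj (u := s)
  have h2 := h.symm.diff_dist_adj (u := s)
  omega

theorem exists_adj_dist_eq {s x : V} (h : G.Reachable s x) (hne : s ≠ x) :
    ∃ y, G.Adj x y ∧ G.dist s x = 1 + G.dist s y := by
  obtain ⟨w, hw⟩ := h.symm.exists_walk_length_eq_dist
  cases w with
  | nil => exact absurd rfl hne
  | @cons _ y _ hxy q =>
    refine ⟨y, hxy, ?_⟩
    have h1 := G.dist_le q
    rw [SimpleGraph.Walk.length_cons] at hw
    rw [SimpleGraph.dist_comm] at hw h1
    have h2 := hxy.diff_dist_adj (u := s)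
    omega

/-- Distance from `s` along a walk, as a function of an integer position. -/
noncomputable def distAlong (p : G.Walk u v) (s : V) (i : ℤ) : ℤ := G.dist s (p.getVert i.toNat)

theorem distAlong_natCast (p : G.Walk u v) (s : V) (i : ℕ) :
    distAlong p s i = G.dist s (p.getVert i) := by
  rw [distAlong, Int.toNat_natCast]

theorem distAlong_lipschitz (p : G.Walk u v) (s : V) (i : ℤ) (h0 : 0 ≤ i) (hi : i < p.length) :
    distAlong p s (i + 1) ≤ distAlong p s i + 1 ∧ distAlong p s i ≤ distAlong p s (i + 1) + 1 := by
  lift i to ℕ using h0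
  have e : (i : ℤ) + 1 = ((i + 1 : ℕ) : ℤ) := by push_cast; rfl
  rw [e, distAlong_natCast, distAlong_natCast]
  exact dist_le_dist_add_one (p.adj_getVert_succ (by omega))

theorem reachable_getVert (p : G.Walk u v) (i : ℕ) : G.Reachable u (p.getVert i) :=
  ⟨p.take i⟩

/-- A shortest path to `s` leaves an internal vertex through one of its only two neighbours, which
are its neighbours on the thread. -/
theorem IsThread.distAlong_rule (hp : IsThread G p) {s : V} (hs : G.Reachable s u) (i : ℤ)
    (h0 : 0 < i) (hi : i < p.length) (hne : p.getVert i.toNat ≠ s) :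
    distAlong p s i = 1 + distAlong p s (i - 1) ∨
      distAlong p s i = 1 + distAlong p s (i + 1) := by
  lift i to ℕ using h0.le
  rw [Int.toNat_natCast] at hne
  have e : (i : ℤ) + 1 = ((i + 1 : ℕ) : ℤ) := by push_cast; rfl
  have e' : (i : ℤ) - 1 = ((i - 1 : ℕ) : ℤ) := by omega
  rw [e, e', distAlong_natCast, distAlong_natCast, distAlong_natCast]
  obtain ⟨y, hy, hd⟩ := exists_adj_dist_eq (hs.trans (reachable_getVert p i)) hne.symm
  rw [hp.adj_iff (by omega) (by omega)] at hy
  rcases hy with rfl | rfl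
  · left; omega
  · right; omega

/-- Along a thread, the distance to a fixed vertex grows or shrinks by one per step, and does so
consistently except at a bounded number of positions. -/
theorem IsThread.exists_steady_dist (hp : IsThread G p) {s : V} (hs : G.Reachable s u) :
    ∃ S : Finset ℕ, S.card ≤ 8 ∧ ∀ k, k + 2 ≤ p.length → k ∉ S →
      distAlong p s ((k + 2 : ℕ) : ℤ) - distAlong p s ((k + 1 : ℕ) : ℤ) =
        distAlong p s ((k + 1 : ℕ) : ℤ) - distAlong p s (k : ℤ) ∧
      (distAlong p s ((k + 1 : ℕ) : ℤ) - distAlong p s (k : ℤ)) % 2 = 1 := by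
  classical
  set d : ℕ → ℤ := fun k => distAlong p s (k : ℤ) with hd
  have hlip : ∀ k, k < p.length → d (k + 1) ≤ d k + 1 ∧ d k ≤ d (k + 1) + 1 := fun k hk => by
    have := distAlong_lipschitz p s k (by omega) (by omega)
    simpa [hd] using this
  have hrule : ∀ k, k + 2 ≤ p.length → p.getVert (k + 1) ≠ s →
      d (k + 1) = 1 + d k ∨ d (k + 1) = 1 + d (k + 2) := fun k hk hne => by
    have := hp.distAlong_rule hs ((k + 1 : ℕ) : ℤ) (by omega) (by omega) (by simpa using hne)
    have e1 : ((k + 1 : ℕ) : ℤ) - 1 = (k : ℤ) := by omega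
    have e2 : ((k + 1 : ℕ) : ℤ) + 1 = ((k + 2 : ℕ) : ℤ) := by omega
    rwa [e1, e2] at this
  set S := (Finset.range (p.length - 1)).filter fun k =>
    ¬ (d (k + 2) - d (k + 1) = d (k + 1) - d k ∧ (d (k + 1) - d k) % 2 = 1) with hS
  refine ⟨S, ?_, fun k hk hkS => ?_⟩
  swap
  · by_contra hcon
    exact hkS (Finset.mem_filter.2 ⟨Finset.mem_range.2 (by omega), hcon⟩)
  set T := (Finset.range (p.length - 1)).filter fun k => p.getVert (k + 1) = s with hT
  have hTcard : T.card ≤ 2 := by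
    refine le_trans ?_ (hp.card_getVert_eq_le s)
    refine Finset.card_le_card_of_injOn (· + 1) (fun k hk => ?_) (fun a _ b _ h => by simpa using h)
    simp only [hT, Finset.coe_filter, Finset.mem_range, Set.mem_ofPred_eq] at hk ⊢
    exact ⟨by omega, hk.2⟩
  -- Away from `s` the increment never grows, and it drops by at least 1 at every bad position. At
  -- `s` it can grow by 2, which the summand 3 compensates. The sum telescopes to at most 2, and at
  -- most two visits to `s` add 6, giving 8.
  have hsum : ((S.card : ℕ) : ℤ) ≤
      ∑ k ∈ Finset.range (p.length - 1), (((d (k + 1) - d k) - (d (k + 2) - d (k + 1))) +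
        3 * if p.getVert (k + 1) = s then 1 else 0) := by
    rw [hS, Finset.card_filter]
    push_cast
    refine Finset.sum_le_sum fun k hk => ?_
    rw [Finset.mem_range] at hk
    have h1 := hlip k (by omega)
    have h2 := hlip (k + 1) (by omega)
    have h3 := hrule k (by omega)
    rw [show k + 1 + 1 = k + 2 from rfl] at h2
    by_cases hks : p.getVert (k + 1) = s
    · simp only [hks, if_true]
      split_ifs <;> omega
    · have h3 := h3 hks
      simp only [hks, if_false]
      split_ifs <;> omega
  rw [Finset.sum_add_distrib, ← Finset.mul_sum,
    Finset.sum_range_sub' (fun k => d (k + 1) - d k), Finset.sum_boole, ← hT] at hsum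
  rcases Nat.lt_or_ge p.length 2 with h | h
  · have e : p.length - 1 = 0 := by omega
    rw [hS, e]
    simp
  · have h1 := hlip 0 (by omega)
    have h2 := hlip (p.length - 1) (by omega)
    simp only [zero_add] at hsum h1
    omega

end Thread

/-! ### The profile of one thread seen from a vertex moving along another. -/

section TwoThreads
variable {V : Type*} {G : SimpleGraph V} {a a' c c' : V} {A : G.Walk a a'} {C : G.Walk c c'}

/-- `x` is the vertex of `A` in the internal position `t`. -/
def IsInternalAt (A : G.Walk a a') (x : V) (t : ℕ) : Prop :=
  0 < t ∧ t < A.length ∧ A.getVert t = x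

open Classical in
/-- The internal position of `x` on `A`, or the length of `A` if there is none. -/
noncomputable def peg (A : G.Walk a a') (x : V) : ℕ :=
  if h : ∃ t, IsInternalAt A x t then h.choose else A.length

theorem IsThread.peg_eq (hA : IsThread G A) {x : V} {t : ℕ} (h : IsInternalAt A x t) :
    peg A x = t := by
  have hex : ∃ t, IsInternalAt A x t := ⟨t, h⟩
  rw [peg, dif_pos hex]
  obtain ⟨h1, h2, h3⟩ := hex.choose_spec
  exact hA.eq_of_getVert_eq h1 h2 h.2.1.le (h3.trans h.2.2.symm)

theorem peg_of_not_exists {x : V} (h : ¬ ∃ t, IsInternalAt A x t) : peg A x = A.length :=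
  dif_neg h

theorem peg_le (A : G.Walk a a') (x : V) : peg A x ≤ A.length := by
  rw [peg]
  split_ifs with h
  · exact h.choose_spec.2.1.le
  · exact le_rfl

/-- The distances from `s` along `A`, as rising and falling runs. -/
noncomputable def profile (A : G.Walk a a') (s : V) : RunFamily (Bool ⊕ Bool) :=
  (RunFamily.tent (distAlong A s 0) (distAlong A s (peg A s)) 0 (peg A s)).append
    (RunFamily.tent (distAlong A s (peg A s)) (distAlong A s A.length) (peg A s) A.length)

/-- The only possible valley inside `A` is at `s`, so neither piece of the cut at `peg A s` has one
in its interior. If `s` is not internal, the second piece is the single last position. -/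
theorem IsThread.profile_traces (hA : IsThread G A) {s : V} (hs : G.Reachable s a) :
    (profile A s).Traces 0 A.length (distAlong A s) := by
  have hle := peg_le A s
  have hne : ∀ i : ℤ, 0 < i → i < A.length → i ≠ peg A s → A.getVert i.toNat ≠ s := by
    intro i h0 hi hne h
    have : peg A s = i.toNat := hA.peg_eq ⟨by omega, by omega, h⟩
    omega
  refine RunFamily.Traces.append (by omega) (by omega) (RunFamily.tent_traces (by omega) ?_ ?_)
    (RunFamily.tent_traces (by omega) ?_ ?_)
  · exact fun i h1 h2 => distAlong_lipschitz A s i h1 (by omega)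
  · exact fun i h1 h2 => hA.distAlong_rule hs i h1 (by omega)
      (hne i h1 (by omega) (by omega))
  · exact fun i h1 h2 => distAlong_lipschitz A s i (by omega) h2
  · exact fun i h1 h2 => hA.distAlong_rule hs i (by omega) h2
      (hne i (by omega) h2 (by omega))

/-- From an internal vertex of `A`, a walk can only step to the two neighbours on `A`. -/
theorem IsThread.step_of_internal (hA : IsThread G A) {x y : V} {t : ℕ} (h : IsInternalAt A x t)
    (hxy : G.Adj x y) (hy : y ≠ a) (hy' : y ≠ a') :
    IsInternalAt A y (t - 1) ∨ IsInternalAt A y (t + 1) := by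
  obtain ⟨h0, h1, rfl⟩ := h
  rcases (hA.adj_iff h0 h1 y).1 hxy with rfl | rfl
  · left
    refine ⟨Nat.pos_of_ne_zero fun e => hy ?_, by omega, rfl⟩
    rw [e, A.getVert_zero]
  · right
    refine ⟨by omega, lt_of_le_of_ne h1 fun e => hy' ?_, rfl⟩
    rw [e, A.getVert_length]

theorem IsThread.profile_tameFamily (hA : IsThread G A) (hC : IsThread G C)
    (hca : G.Reachable c a) :
    RunFamily.TameFamily C.length 28 fun k => profile A (C.getVert k) := by
  classical
  have hsymm : ∀ x k, distAlong C x ((k : ℕ) : ℤ) = G.dist (C.getVert k) x := fun x k => by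
    rw [distAlong_natCast, SimpleGraph.dist_comm]
  obtain ⟨S₁, hS₁, h₁⟩ := hC.exists_steady_dist (s := a) hca.symm
  obtain ⟨S₂, hS₂, h₂⟩ := hC.exists_steady_dist (s := a')
    ((SimpleGraph.Walk.reachable A.reverse).trans hca.symm)
  simp only [hsymm] at h₁ h₂
  set F : V → Finset ℕ := fun x =>
    (Finset.range (C.length + 1)).filter fun k => C.getVert k = x with hF
  set T := F a ∪ F a' with hTdef
  have hTcard : T.card ≤ 4 := by
    have := Finset.card_union_le (F a) (F a')
    have h3 := hC.card_getVert_eq_le a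
    have h4 := hC.card_getVert_eq_le a'
    exact this.trans (add_le_add h3 h4)
  have hT : ∀ k, k ≤ C.length → k ∉ T → C.getVert k ≠ a ∧ C.getVert k ≠ a' := by
    intro k hk hkT
    simp only [hTdef, hF, Finset.mem_union, Finset.mem_filter, Finset.mem_range, not_or,
      not_and] at hkT
    exact ⟨hkT.1 (by omega), hkT.2 (by omega)⟩
  -- The shifts of `T` keep three consecutive vertices of `C` away from the ends of `A`. The size is
  -- at most 8 + 8 + 3 · 4 = 28.
  set S := (S₁ ∪ S₂) ∪ (T ∪ (T.image (· - 1) ∪ T.image (· - 2))) with hSdef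
  have hScard : S.card ≤ 28 := by
    have h1 := Finset.card_union_le (S₁ ∪ S₂) (T ∪ (T.image (· - 1) ∪ T.image (· - 2)))
    have h2 := Finset.card_union_le S₁ S₂
    have h3 := Finset.card_union_le T (T.image (· - 1) ∪ T.image (· - 2))
    have h4 := Finset.card_union_le (T.image (· - 1)) (T.image (· - 2))
    have h5 := Finset.card_image_le (s := T) (f := (· - 1))
    have h6 := Finset.card_image_le (s := T) (f := (· - 2))
    rw [hSdef]
    omega
  have hp : ∀ s, distAlong A s 0 = G.dist s a := fun s => by
    simpa using distAlong_natCast A s 0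
  have hq : ∀ s, distAlong A s A.length = G.dist s a' := fun s => by
    simpa using distAlong_natCast A s A.length
  have hin : ∀ {s t}, IsInternalAt A s t → distAlong A s t = 0 := fun h => by
    rw [distAlong_natCast, h.2.2, SimpleGraph.dist_self, Nat.cast_zero]
  -- Away from the ends of `A`, a step of `C` cannot enter or leave the interior of `A`. So either
  -- the three vertices are all internal and, not turning back, move along `A` in one direction, or
  -- none is internal.
  have key : ∀ k, k + 2 ≤ C.length → k ∉ S →
      (∃ t : ℕ → ℤ, (∀ i ≤ 2, (peg A (C.getVert (k + i)) : ℤ) = t i) ∧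
        (∀ i ≤ 2, distAlong A (C.getVert (k + i)) (peg A (C.getVert (k + i))) = 0) ∧
        t 2 - t 1 = t 1 - t 0 ∧ (t 1 - t 0) % 2 = 1) ∨
      ∀ i ≤ 2, peg A (C.getVert (k + i)) = A.length := by
    intro k hk hkS
    simp only [hSdef, Finset.mem_union, Finset.mem_image, not_or, not_exists, not_and] at hkS
    obtain ⟨-, hk0, hk1, hk2⟩ := hkS
    obtain ⟨n0, n0'⟩ := hT k (by omega) hk0
    obtain ⟨n1, n1'⟩ := hT (k + 1) (by omega) fun h => hk1 _ h (by omega)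
    obtain ⟨n2, n2'⟩ := hT (k + 2) (by omega) fun h => hk2 _ h (by omega)
    have a0 : G.Adj (C.getVert k) (C.getVert (k + 1)) := C.adj_getVert_succ (by omega)
    have a1 : G.Adj (C.getVert (k + 1)) (C.getVert (k + 2)) := C.adj_getVert_succ (by omega)
    have hne : C.getVert k ≠ C.getVert (k + 2) :=
      hC.getVert_sub_one_ne (i := k + 1) (by omega) (by omega)
    by_cases hmid : ∃ t, IsInternalAt A (C.getVert (k + 1)) t
    · left
      obtain ⟨t, ht⟩ := hmid
      have ht0 := ht.1
      have b0 := hA.step_of_internal ht a0.symm n0 n0'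
      have b2 := hA.step_of_internal ht a1 n2 n2'
      have fin : ∀ t0 t2 : ℕ, IsInternalAt A (C.getVert k) t0 →
          IsInternalAt A (C.getVert (k + 2)) t2 → (t2 : ℤ) - t = t - t0 → ((t : ℤ) - t0) % 2 = 1 →
          ∃ t : ℕ → ℤ, (∀ i ≤ 2, (peg A (C.getVert (k + i)) : ℤ) = t i) ∧
            (∀ i ≤ 2, distAlong A (C.getVert (k + i)) (peg A (C.getVert (k + i))) = 0) ∧
            t 2 - t 1 = t 1 - t 0 ∧ (t 1 - t 0) % 2 = 1 := by
        intro t0 t2 h0 h2 e1 e2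
        refine ⟨fun i => peg A (C.getVert (k + i)), fun _ _ => rfl, ?_, ?_⟩
        · intro i hi
          interval_cases i
          · rw [add_zero, hA.peg_eq h0, hin h0]
          · rw [hA.peg_eq ht, hin ht]
          · rw [hA.peg_eq h2, hin h2]
        · simp only [add_zero, hA.peg_eq h0, hA.peg_eq ht, hA.peg_eq h2]
          exact ⟨e1, e2⟩
      rcases b0 with b0 | b0 <;> rcases b2 with b2 | b2
      · exact absurd (b0.2.2.symm.trans b2.2.2) hne
      · exact fin _ _ b0 b2 (by omega) (by omega)
      · exact fin _ _ b0 b2 (by omega) (by omega)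
      · exact absurd (b0.2.2.symm.trans b2.2.2) hne
    · right
      have h0 : ¬ ∃ t, IsInternalAt A (C.getVert k) t := by
        rintro ⟨t, ht⟩
        rcases hA.step_of_internal ht a0 n1 n1' with h | h <;> exact hmid ⟨_, h⟩
      have h2 : ¬ ∃ t, IsInternalAt A (C.getVert (k + 2)) t := by
        rintro ⟨t, ht⟩
        rcases hA.step_of_internal ht a1.symm n1 n1' with h | h <;> exact hmid ⟨_, h⟩
      intro i hi
      interval_cases i
      · exact peg_of_not_exists h0
      · exact peg_of_not_exists hmid
      · exact peg_of_not_exists h2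
  have hlin : ∀ k, k + 2 ≤ C.length → k ∉ S →
      ((G.dist (C.getVert (k + 2)) a : ℤ) - G.dist (C.getVert (k + 1)) a =
        G.dist (C.getVert (k + 1)) a - G.dist (C.getVert k) a ∧
      ((G.dist (C.getVert (k + 1)) a : ℤ) - G.dist (C.getVert k) a) % 2 = 1) ∧
      ((G.dist (C.getVert (k + 2)) a' : ℤ) - G.dist (C.getVert (k + 1)) a' =
        G.dist (C.getVert (k + 1)) a' - G.dist (C.getVert k) a' ∧
      ((G.dist (C.getVert (k + 1)) a' : ℤ) - G.dist (C.getVert k) a') % 2 = 1) := by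
    intro k hk hkS
    simp only [hSdef, Finset.mem_union, not_or] at hkS
    exact ⟨h₁ k hk hkS.1.1, h₂ k hk hkS.1.2⟩
  -- Either the cut moves by ±1 and its distance stays 0, or it stays at the last position and its
  -- distance, now to `a'`, changes by an odd amount. Both ways the sum of position and distance
  -- changes by an odd amount, as the distances to the ends do; this yields the evenness needed for
  -- the two tents.
  have cases3 : ∀ k, k + 2 ≤ C.length → k ∉ S →
      (((peg A (C.getVert (k + 2)) : ℤ) - peg A (C.getVert (k + 1)) =
          peg A (C.getVert (k + 1)) - peg A (C.getVert k)) ∧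
        distAlong A (C.getVert (k + 2)) (peg A (C.getVert (k + 2))) -
          distAlong A (C.getVert (k + 1)) (peg A (C.getVert (k + 1))) =
        distAlong A (C.getVert (k + 1)) (peg A (C.getVert (k + 1))) -
          distAlong A (C.getVert k) (peg A (C.getVert k))) ∧
      ((peg A (C.getVert (k + 1)) : ℤ) - peg A (C.getVert k) +
        (distAlong A (C.getVert (k + 1)) (peg A (C.getVert (k + 1))) -
          distAlong A (C.getVert k) (peg A (C.getVert k)))) % 2 = 1 := by
    intro k hk hkS
    have hl := hlin k hk hkS
    rcases key k hk hkS with ⟨t, e1, e2, e3, e4⟩ | e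
    · have f0 := e1 0 (by omega)
      have f1 := e1 1 (by omega)
      have f2 := e1 2 (by omega)
      have g0 := e2 0 (by omega)
      have g1 := e2 1 (by omega)
      have g2 := e2 2 (by omega)
      rw [add_zero] at f0 g0
      rw [g0, g1, g2, f0, f1, f2]
      omega
    · have f0 := e 0 (by omega)
      have f1 := e 1 (by omega)
      have f2 := e 2 (by omega)
      rw [add_zero] at f0
      rw [f0, f1, f2, hq, hq, hq]
      omega
  refine RunFamily.TameFamily.append (RunFamily.tent_tameFamily hScard ?_ ?_ ?_ ?_ ?_)
    (RunFamily.tent_tameFamily hScard ?_ ?_ ?_ ?_ ?_) <;> intro k hk hkS <;>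
    have h1 := hlin k hk hkS <;> have h2 := cases3 k hk hkS <;> simp only [hp, hq] <;> omega

end TwoThreads

/-! ### Indistinct sets in terms of profiles, and the final count. -/

theorem indistinctSet_eq {V : Type*} {G : SimpleGraph V} {a a' b b' : V} (A : G.Walk a a')
    (B : G.Walk b b') {s : V} (ha : G.Reachable s a) (hb : G.Reachable s b) :
    indistinctSet G A B s = {z : ℤ × ℤ | 0 ≤ z.1 ∧ z.1 ≤ A.length ∧ 0 ≤ z.2 ∧ z.2 ≤ B.length ∧
      distAlong A s z.1 = distAlong B s z.2} := by
  have hd : ∀ i j : ℕ, G.edist s (A.getVert i) = G.edist s (B.getVert j) ↔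
      distAlong A s i = distAlong B s j := fun i j => by
    rw [distAlong_natCast, distAlong_natCast,
      ← (ha.trans (reachable_getVert A i)).coe_dist_eq_edist,
      ← (hb.trans (reachable_getVert B j)).coe_dist_eq_edist]
    norm_cast
  ext ⟨x, y⟩
  constructor
  · rintro ⟨i, j, hi, hj, h, ⟨⟩⟩
    exact ⟨by simp only; omega, by simp only; omega, by simp only; omega, by simp only; omega,
      (hd i j).1 h⟩
  · rintro ⟨h1, h2, h3, h4, h5⟩
    simp only at h1 h2 h3 h4 h5
    lift x to ℕ using h1
    lift y to ℕ using h3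
    exact ⟨x, y, by omega, by omega, (hd x y).2 h5, rfl⟩

/-- With at least one branch at infinite distance, the set is everything if both are infinitely far
and empty otherwise, and this depends only on the component. -/
theorem indistinctSet_eq_of_not_reachable {V : Type*} {G : SimpleGraph V} {a a' b b' : V}
    (A : G.Walk a a') (B : G.Walk b b') {s t : V} (hst : G.Reachable s t)
    (h : ¬ (G.Reachable s a ∧ G.Reachable s b)) :
    indistinctSet G A B s = indistinctSet G A B t := by
  have top : ∀ {x y z : V} (P : G.Walk x y) (i : ℕ), G.edist z (P.getVert i) = ⊤ ↔
      ¬ G.Reachable z x := fun P i => by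
    rw [← not_iff_not, not_not, ← ne_eq, SimpleGraph.edist_ne_top_iff_reachable]
    exact ⟨fun h => h.trans (reachable_getVert P i).symm, fun h => h.trans (reachable_getVert P i)⟩
  have hra : G.Reachable s a ↔ G.Reachable t a := ⟨hst.symm.trans, hst.trans⟩
  have hrb : G.Reachable s b ↔ G.Reachable t b := ⟨hst.symm.trans, hst.trans⟩
  have key : ∀ z, (G.Reachable s a ↔ G.Reachable z a) → (G.Reachable s b ↔ G.Reachable z b) →
      ∀ i j, G.edist z (A.getVert i) = G.edist z (B.getVert j) ↔
        (¬ G.Reachable s a ∧ ¬ G.Reachable s b) := by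
    intro z hza hzb i j
    have hta : G.edist z (A.getVert i) = ⊤ ↔ ¬ G.Reachable z a := top A i
    have htb : G.edist z (B.getVert j) = ⊤ ↔ ¬ G.Reachable z b := top B j
    rw [hza, hzb, not_and_or, ← hta, ← htb] at h
    rw [hza, hzb, ← hta, ← htb]
    constructor
    · intro e
      rw [e, or_self] at h
      rw [e, and_self]
      exact h
    · rintro ⟨e, e'⟩
      rw [e, e']
  ext z
  simp only [indistinctSet, Set.mem_ofPred_eq, key s Iff.rfl Iff.rfl, key t hra hrb]

theorem IsThread.ncard_changePositions_le {V : Type*} {G : SimpleGraph V} {a a' b b' c c' : V}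
    {A : G.Walk a a'} {B : G.Walk b b'} {C : G.Walk c c'} (hA : IsThread G A) (hB : IsThread G B)
    (hC : IsThread G C) :
    (changePositions G A B C).ncard ≤
      Fintype.card (Mark ((Bool ⊕ Bool) × (Bool ⊕ Bool)) × Mark ((Bool ⊕ Bool) × (Bool ⊕ Bool))) *
        (676 + 676 + 1) := by
  classical
  by_cases hr : G.Reachable c a ∧ G.Reachable c b
  -- Pairing turns the bound 28 into 12 · 28 + 2 = 338, and passing to marks doubles it to 676.
  · have ht := (hA.profile_tameFamily hC hr.1).pairing (hB.profile_tameFamily hC hr.2)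
    set M := fun k => (profile A (C.getVert k)).pairing (profile B (C.getVert k)) with hM
    have hfill : ∀ k, (M k).Fills (indistinctSet G A B (C.getVert k)) := fun k => by
      have ha := (reachable_getVert C k).symm.trans hr.1
      have hb := (reachable_getVert C k).symm.trans hr.2
      rw [indistinctSet_eq A B ha hb]
      exact (hA.profile_traces ha).fills_pairing (hB.profile_traces hb)
    refine le_trans ?_ (RunFamily.card_not_samePattern_le (L := C.length) M ht.slope ht.val)
    rw [← Set.ncard_coe_finset]
    refine Set.ncard_le_ncard (fun k hk => ?_) (Finset.finite_toSet _)
    rw [Finset.coe_filter]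
    refine ⟨Finset.mem_range.2 hk.1, fun hp => hk.2 ?_⟩
    exact Quotient.sound (hp.combEquiv (hfill k) (hfill (k + 1)))
  · have : changePositions G A B C = ∅ := by
      rw [Set.eq_empty_iff_forall_notMem]
      rintro k ⟨-, hk⟩
      refine hk (congrArg _ (indistinctSet_eq_of_not_reachable A B
        ((reachable_getVert C k).symm.trans (reachable_getVert C (k + 1))) fun h => hr ?_))
      exact ⟨(reachable_getVert C k).trans h.1, (reachable_getVert C k).trans h.2⟩
    rw [this, Set.ncard_empty]
    exact Nat.zero_le _

end Branches

theorem mainTheorem8 :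
    ∃ K : ℕ, ∀ (V : Type*) (G : SimpleGraph V) (a a' b b' c c' : V)
      (A : G.Walk a a') (B : G.Walk b b') (C : G.Walk c c'),
      Branches.IsBranch G A → Branches.IsBranch G B → Branches.IsBranch G C →
        (Branches.changePositions G A B C).ncard ≤ K :=
  ⟨_, fun _ _ _ _ _ _ _ _ _ _ _ hA hB hC => hA.1.ncard_changePositions_le hB.1 hC.1⟩
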